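/- Let $\kappa$ be a strongly inaccessible cardinal, let $S\subseteq\kappa$ be stationary, and let $\bar C=\langle C_\delta:\delta\in S\rangle$ be such that for each $\delta\in S$: $C_\delta$ is a club of $\delta$ with $\mathrm{otp}(C_\delta)<\delta$ and $\mathrm{otp}(C_\delta)<\min C_\delta$; every $\alpha\in\mathrm{nacc}(C_\delta)$ satisfies $\alpha\notin S$, $S\cap\alpha$ is not stationary in $\alpha$, and $\mathrm{cf}(\alpha)>2^{|\max(C_\delta\cap\alpha)|}$ (when $C_\delta\cap\alpha\neq\emptyset$); and $C_\alpha=C_\delta\cap\alpha$ for $\alpha\in\mathrm{acc}(C_\delta)\cap S$. Assume that $\bar C$ guesses clubs (for every club $E\subseteq\kappa$ the set $\{\delta\in S:C_\delta\subseteq E\}$ is stationary) and that for every club $E\subseteq\kappa$ and every $\zeta<\kappa$ there is an increasing continuous sequence of length $\zeta$ of elements of $E\setminus S$. Let $\theta<\kappa$ be a regular cardinal and, for $\delta\in S$, let $A_\delta\subseteq\delta$, $|A_\delta|<\theta$, $\sup A_\delta=\delta$, $h_\delta:A_\delta\to\theta$. Let $\mathbb Q=\mathbb Q^{S,\theta}_{\bar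 A,\bar h}$ be the set of all functions $g:\beta\to\theta$, $\beta<\kappa$, such that for every $\delta\in S\cap(\beta+1)$ the set $\{\xi\in A_\delta:h_\delta(\xi)\ne g(\xi)\}$ is bounded in $\delta$, ordered by extension (larger is stronger). Put $\mathcal I_\alpha=\{g\in\mathbb Q:\alpha\in\mathrm{dom}(g)\}$. Let $\hat{\mathcal E}_0=\hat{\mathcal E}^S_0$ be the family of all increasing continuous sequences $\langle\alpha_i:i\le\gamma\rangle$, $\gamma<\kappa$, of ordinals from $\kappa\setminus S$, and let $\hat{\mathcal E}_1=\hat{\mathcal E}^{S,\bar C}_1$ be the family of all nonempty end segments of the sequences $\bar\beta{}^\frown\langle\delta\rangle$, where $\delta\in S$ and $\bar\beta$ is the increasing enumeration of $C_\delta$. **Conclusion.** If $\mathcal I_\alpha$ is dense in $\mathbb Q$ for every $\alpha<\kappa$, then $\mathbb Q$ is complete for $(\hat{\mathcal E}_0,\hat{\mathcal E}_1)$, that is, (a) and (b) below hold. Moreover, the density assumption holds, for instance, whenever $S$ does not reflect (no $S\cap\alpha$ with $\alpha<\kappa$, $\mathrm{cf}(\alpha)>\aleph_0$, is stationary in $\alpha$)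 and $A_\delta\cap\delta'$ is bounded in $\delta'$ for all $\delta'<\delta$ in $S$ (e.g. every $A_\delta$ has order type $\omega$). *Terminology.* For regular $\chi$ and a well-ordering $<^*_\chi$ of $H(\chi)$, "submodel" means elementary submodel of $(H(\chi),\in,<^*_\chi)$. An $\hat{\mathcal E}_0$-complementary pair is $(\bar N,\bar a)$ with $\bar a=\langle a_i:i\le\gamma\rangle\in\hat{\mathcal E}_0$ and $\bar N=\langle N_i:i\le\gamma\rangle$ an increasing continuous sequence of submodels such that $\bar N\restriction(i+1)\in N_{i+1}$ and $|N_i|<\kappa$ for $i<\gamma$, and for some $n<\omega$, $a_i\subseteq N_i\cap\kappa\subseteq a_{i+n}$ for all $i<\gamma$ (the upper inclusion when $i+n\le\gamma$). If $\bar N=\langle N_i:i\le\gamma\rangle$ and $\mathbb Q\in N_0$, an increasing sequence $\bar p=\langle p_i:i<\gamma\rangle$ of conditions in $N_\gamma$ is $(\bar N,\mathbb Q)^*$-generic if for some $n<\omega$ and all $i<\gamma$: $\bar p\restriction(i+1)\in N_{i+1}$ and (when $i+n<\gamma$) $p_{i+n}$ belongs to every open dense subset of $\mathbb Q$ lying in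 $N_i$. "For most" means: for all large enough regular $\chi$ (and every well-ordering of $H(\chi)$) there is $x\in H(\chi)$ such that the assertion holds for all sequences of submodels whose first member contains $x$. (a) $\mathbb Q$ is strongly complete for $\hat{\mathcal E}_0$: for most $\hat{\mathcal E}_0$-complementary pairs $(\bar N,\bar a)$ with $\mathbb Q\in N_0$, every increasing $(\bar N,\mathbb Q)^*$-generic sequence has an upper bound in $\mathbb Q$; and forcing with $\mathbb Q$ adds no new sequences of ordinals of length $<\kappa$. (b) For most sequences $\bar M=\langle M_i:i\le\delta\rangle$ ruled by $(\hat{\mathcal E}_0,\hat{\mathcal E}_1)$ with an approximation $\langle\bar N^i:-1\le i<\delta\rangle$, and for every $r\in\mathbb Q\cap M_0$, player INC has no winning strategy in the $\spadesuit$-game below. Here $\bar M$ is ruled by $(\hat{\mathcal E}_0,\hat{\mathcal E}_1)$ with approximation $\langle\bar N^i\rangle$ if $\bar M$ is an increasing continuous sequence of submodels, $\bar M\restriction(i+1)\in M_{i+1}$ and $2^{|M_i|}+1\subseteq M_{i+1}$ for $i<\delta$, $\langle M_i\cap\kappa:i\le\delta\rangle\in\hat{\mathcal E}_1$, and for each $-1\le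 i<\delta$ (with $M_{-1}=\emptyset$) $\bar N^i=\langle N^i_\varepsilon:\varepsilon\le\delta_i\rangle$ is the first coordinate of an $\hat{\mathcal E}_0$-complementary pair, $\delta_i$ is additively indecomposable, $\mathrm{cf}(\delta_i)>2^{|M_i|}$, $\bar M\restriction(i+1)\in N^i_0$, $N^i_{\delta_i}=M_{i+1}$, and $|N^i_\varepsilon|^{2^{|M_i|}}+1\subseteq N^i_{\varepsilon+1}$ for $\varepsilon<\delta_i$. The $\spadesuit$-game: INC first chooses a non-limit $i_0<\delta$ (possibly $0$) and $p\in\mathbb Q\cap M_{i_0}$ with $p\ge r$. At stage $i\in[i_0-1,\delta)$ COM chooses $p_i\in\mathbb Q\cap M_{i+1}$ above $p$ and above all $q_{j,\varepsilon}$ with $i_0-1\le j<i$, $\varepsilon<\delta_j$; then INC chooses an increasing sequence $\langle q_{i,\varepsilon}:\varepsilon<\delta_i\rangle$ of conditions with $p_i\le q_{i,0}$ which is $(\bar N^i\restriction[\alpha,\delta_i],\mathbb Q)^*$-generic for some $\alpha<\delta_i$. COM wins if he always has legal moves and $\langle p_i:i_0-1\le i<\delta\rangle$ has an upper bound in $\mathbb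 Q$. -/

import Mathlib

open Cardinal Ordinal Order Set

universe u

namespace UnifForcing

/-! ### Set-theoretic background: sequences, `H(χ)` and elementary submodels -/

/-- The set-theoretic sequence `⟨f j : j < o⟩`, that is the set of pairs `(j, f j)` with `j < o`. -/
noncomputable def seqCode (f : Ordinal.{u} → ZFSet.{u}) (o : Ordinal.{u}) : ZFSet.{u} :=
  ZFSet.range (fun j : Set.Iio o => ZFSet.pair (j : Ordinal.{u}).toZFSet (f j))

/-- `x` is hereditarily of cardinality `< χ`. -/
def InH (χ : Cardinal.{u}) (x : ZFSet.{u}) : Prop :=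
  ZFSet.Hereditarily (fun y => y.card < χ) x

/-- The collection `H(χ)`. -/
def H (χ : Cardinal.{u}) : Type (u + 1) := {x : ZFSet.{u} // InH χ x}

/-- Relation symbols: membership and a symbol for the well-ordering of `H(χ)`. -/
inductive HRel : ℕ → Type
  | mem : HRel 2
  | lt : HRel 2

/-- The first-order language with these two binary relation symbols. -/
def HLang : FirstOrder.Language.{0, 0} := ⟨fun _ => Empty, HRel⟩

/-- The structure `(H(χ), ∈, W)`. -/
@[reducible] def HStruct (χ : Cardinal.{u}) (W : H χ → H χ → Prop) : HLang.Structure (H χ) where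
  funMap := fun f _ => Empty.elim f
  RelMap := fun {n} (r : HRel n) =>
    match n, r with
    | 2, HRel.mem => fun v => (v 0).1 ∈ (v 1).1
    | 2, HRel.lt => fun v => W (v 0) (v 1)

/-- `N` is (the universe of) an elementary submodel of `(H(χ), ∈, W)`. -/
def IsElemSub (χ : Cardinal.{u}) (W : H χ → H χ → Prop) (N : ZFSet.{u}) : Prop :=
  letI : HLang.Structure (H χ) := HStruct χ W
  ∃ E : HLang.ElementarySubstructure (H χ),
    ∀ x : ZFSet.{u}, x ∈ N ↔ ∃ hx : InH χ x, (⟨x, hx⟩ : H χ) ∈ E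

/-- `⟨N i : i ≤ δ⟩` is an increasing continuous sequence of elementary submodels of
`(H(χ), ∈, W)`. -/
structure IsModelChain (χ : Cardinal.{u}) (W : H χ → H χ → Prop)
    (N : Ordinal.{u} → ZFSet.{u}) (δ : Ordinal.{u}) : Prop where
  elem : ∀ i ≤ δ, IsElemSub χ W (N i)
  mono : ∀ i j, i ≤ j → j ≤ δ → N i ⊆ N j
  cont : ∀ i ≤ δ, IsSuccLimit i → ∀ x, x ∈ N i ↔ ∃ j < i, x ∈ N j

/-! ### Families of sequences of sets of ordinals -/

/-- A sequence `⟨val i : i ≤ last⟩` of sets; the values beyond `last` are irrelevant. -/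
structure SetSeq : Type (u + 1) where
  last : Ordinal.{u}
  val : Ordinal.{u} → ZFSet.{u}

/-- `N̄` obeys `ā` with error `n`; the upper inclusion is required whenever `a (i + n)` is defined. -/
def ObeysWithError (μ : Cardinal.{u}) (N : Ordinal.{u} → ZFSet.{u}) (a : SetSeq.{u}) (n : ℕ) :
    Prop :=
  ∀ i < a.last, a.val i ⊆ N i ∩ μ.ord.toZFSet ∧
    (i + n ≤ a.last → N i ∩ μ.ord.toZFSet ⊆ a.val (i + n))

/-- `(N̄, ā)` is an `E`-complementary pair, where `N̄ = ⟨N i : i ≤ a.last⟩`. -/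
structure IsComplementaryPair (κ μ χ : Cardinal.{u}) (W : H χ → H χ → Prop)
    (E : Set SetSeq.{u}) (N : Ordinal.{u} → ZFSet.{u}) (a : SetSeq.{u}) : Prop where
  mem : a ∈ E
  chain : IsModelChain χ W N a.last
  initial_mem : ∀ i < a.last, seqCode N (i + 1) ∈ N (i + 1)
  card_lt : ∀ i < a.last, (N i).card < κ
  obeys : ∃ n : ℕ, ObeysWithError μ N a n

/-! ### Forcing notions -/

/-- A forcing notion: a set with a reflexive transitive relation; larger means stronger. -/
structure ForcingNotion : Type (u + 1) where
  carrier : ZFSet.{u}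
  le : ZFSet.{u} → ZFSet.{u} → Prop
  le_refl : ∀ p ∈ carrier, le p p
  le_trans : ∀ p ∈ carrier, ∀ q ∈ carrier, ∀ r ∈ carrier, le p q → le q r → le p r

namespace ForcingNotion

/-- The forcing notion as a set: the pair of its underlying set and its order relation. -/
noncomputable def code (Q : ForcingNotion.{u}) : ZFSet.{u} :=
  ZFSet.pair Q.carrier (ZFSet.pairSep Q.le Q.carrier Q.carrier)

/-- `I` is a dense subset of `Q`. -/
def IsDense (Q : ForcingNotion.{u}) (I : ZFSet.{u}) : Prop :=
  I ⊆ Q.carrier ∧ ∀ p ∈ Q.carrier, ∃ q ∈ I, Q.le p q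

/-- `I` is an open dense subset of `Q`. -/
def IsOpenDense (Q : ForcingNotion.{u}) (I : ZFSet.{u}) : Prop :=
  Q.IsDense I ∧ ∀ p ∈ I, ∀ q ∈ Q.carrier, Q.le p q → q ∈ I

/-- Two conditions are compatible. -/
def Compatible (Q : ForcingNotion.{u}) (p q : ZFSet.{u}) : Prop :=
  ∃ r ∈ Q.carrier, Q.le p r ∧ Q.le q r

/-- `⟨p i : i < δ⟩` is an increasing sequence of conditions. -/
def IsIncreasing (Q : ForcingNotion.{u}) (p : Ordinal.{u} → ZFSet.{u}) (δ : Ordinal.{u}) : Prop :=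
  (∀ i < δ, p i ∈ Q.carrier) ∧ ∀ i j, i ≤ j → j < δ → Q.le (p i) (p j)

/-- The increasing sequence `⟨p i : i < δ⟩` of conditions is `(N̄, Q)^n`-generic, where
`N̄ = ⟨N i : i ≤ δ⟩`; the demand on `p (i + n)` is made whenever `i + n < δ`. -/
structure IsGeneric (Q : ForcingNotion.{u}) (N : Ordinal.{u} → ZFSet.{u}) (δ : Ordinal.{u})
    (p : Ordinal.{u} → ZFSet.{u}) (n : ℕ) : Prop where
  code_mem : Q.code ∈ N 0
  increasing : Q.IsIncreasing p δ
  mem : ∀ i < δ, p i ∈ N δ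
  initial_mem : ∀ i < δ, seqCode p (i + 1) ∈ N (i + 1)
  meets : ∀ i, i + n < δ → ∀ I ∈ N i, Q.IsOpenDense I → p (i + n) ∈ I

/-- `Q` is complete for the family `E`. -/
def CompleteFor (Q : ForcingNotion.{u}) (κ μ : Cardinal.{u}) (E : Set SetSeq.{u}) : Prop :=
  ∃ χ₀ : Cardinal.{u}, ∀ χ : Cardinal.{u}, χ₀ ≤ χ → χ.IsRegular →
    ∀ W : H χ → H χ → Prop, IsWellOrder (H χ) W →
      ∃ x : ZFSet.{u}, InH χ x ∧
        ∀ (N : Ordinal.{u} → ZFSet.{u}) (a : SetSeq.{u}) (p : Ordinal.{u} → ZFSet.{u}),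
          IsComplementaryPair κ μ χ W E N a → Q.code ∈ N 0 → x ∈ N 0 →
          (∃ n : ℕ, Q.IsGeneric N a.last p n) →
          ∃ q ∈ Q.carrier, ∀ i < a.last, Q.le (p i) q

/-- A canonical `Q`-name for an ordinal: a maximal antichain together with the values which its
members force. -/
structure OrdName (Q : ForcingNotion.{u}) : Type (u + 1) where
  antichain : Set ZFSet.{u}
  val : ZFSet.{u} → Ordinal.{u}
  subset : ∀ a ∈ antichain, a ∈ Q.carrier
  incompatible : ∀ a ∈ antichain, ∀ b ∈ antichain, a ≠ b → ¬ Q.Compatible a b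
  maximal : ∀ p ∈ Q.carrier, ∃ a ∈ antichain, Q.Compatible p a

/-- The condition `q` forces that the name `τ` has the value `γ`. -/
def OrdName.ForcesEq {Q : ForcingNotion.{u}} (τ : Q.OrdName) (q : ZFSet.{u}) (γ : Ordinal.{u}) :
    Prop :=
  ∀ a ∈ τ.antichain, Q.Compatible q a → τ.val a = γ

/-- Forcing with `Q` adds no new sequences of ordinals of length `< κ`: every name for a sequence of
ordinals of length `ζ < κ` is forced, by densely many conditions, to be equal to a sequence from
the ground model. -/
def AddsNoNewSequences (Q : ForcingNotion.{u}) (κ : Cardinal.{u}) : Prop :=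
  ∀ ζ < κ.ord, ∀ τ : Ordinal.{u} → Q.OrdName, ∀ p ∈ Q.carrier,
    ∃ q ∈ Q.carrier, Q.le p q ∧ ∃ f : Ordinal.{u} → Ordinal.{u},
      ∀ i < ζ, (τ i).ForcesEq q (f i)

/-- `Q` is strongly complete for the family `E`. -/
def StronglyCompleteFor (Q : ForcingNotion.{u}) (κ μ : Cardinal.{u}) (E : Set SetSeq.{u}) : Prop :=
  Q.CompleteFor κ μ E ∧ Q.AddsNoNewSequences κ

end ForcingNotion

/-! ### Ruled sequences of models -/

/-- The index `i + 1`, where `⊥` plays the role of the index `-1`. -/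
noncomputable def nxt : WithBot Ordinal.{u} → Ordinal.{u}
  | ⊥ => 0
  | (i : Ordinal.{u}) => i + 1

/-- The cardinality of `M i`, with the convention that `M (-1)` is empty. -/
noncomputable def cardAt (M : Ordinal.{u} → ZFSet.{u}) : WithBot Ordinal.{u} → Cardinal.{u}
  | ⊥ => 0
  | (i : Ordinal.{u}) => (M i).card

/-- `⟨M i : i ≤ δ⟩` is ruled by `(E₀, E₁)`, with `E₀`-approximation `⟨N̄ⁱ : -1 ≤ i < δ⟩`, where
`N̄ⁱ = ⟨N i ε : ε ≤ d i⟩`. -/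
structure IsRuledBy (κ μ χ : Cardinal.{u}) (W : H χ → H χ → Prop) (E₀ E₁ : Set SetSeq.{u})
    (M : Ordinal.{u} → ZFSet.{u}) (δ : Ordinal.{u})
    (N : WithBot Ordinal.{u} → Ordinal.{u} → ZFSet.{u})
    (d : WithBot Ordinal.{u} → Ordinal.{u}) : Prop where
  chain : IsModelChain χ W M δ
  initial_mem : ∀ i < δ, seqCode M (i + 1) ∈ M (i + 1)
  power_subset : ∀ i < δ, (((2 : Cardinal.{u}) ^ (M i).card).ord + 1).toZFSet ⊆ M (i + 1)
  trace_mem : (⟨δ, fun i => M i ∩ μ.ord.toZFSet⟩ : SetSeq.{u}) ∈ E₁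
  complementary : ∀ i : WithBot Ordinal.{u}, i < (δ : WithBot Ordinal.{u}) →
    ∃ a : SetSeq.{u}, a.last = d i ∧ IsComplementaryPair κ μ χ W E₀ (N i) a
  cof_gt : ∀ i : WithBot Ordinal.{u}, i < (δ : WithBot Ordinal.{u}) →
    (2 : Cardinal.{u}) ^ cardAt M i < (d i).cof
  indecomposable : ∀ i : WithBot Ordinal.{u}, i < (δ : WithBot Ordinal.{u}) →
    ∀ α < d i, ∀ β < d i, α + β < d i
  initial_mem_zero : ∀ i : WithBot Ordinal.{u}, i < (δ : WithBot Ordinal.{u}) →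
    seqCode M (nxt i) ∈ N i 0
  top_eq : ∀ i : WithBot Ordinal.{u}, i < (δ : WithBot Ordinal.{u}) → N i (d i) = M (nxt i)
  approx_power_subset : ∀ i : WithBot Ordinal.{u}, i < (δ : WithBot Ordinal.{u}) → ∀ ε < d i,
    (((N i ε).card ^ ((2 : Cardinal.{u}) ^ cardAt M i)).ord + 1).toZFSet ⊆ N i (ε + 1)

/-! ### The game -/

namespace Game

/-- The data of the game: the forcing notion, the ruled sequence `⟨M i : i ≤ δ⟩`, its
approximation `⟨N i ε : ε ≤ d i⟩`, and the condition `r`. -/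
structure Board : Type (u + 1) where
  Q : ForcingNotion.{u}
  M : Ordinal.{u} → ZFSet.{u}
  δ : Ordinal.{u}
  N : WithBot Ordinal.{u} → Ordinal.{u} → ZFSet.{u}
  d : WithBot Ordinal.{u} → Ordinal.{u}
  r : ZFSet.{u}

/-- Legality of the opening of INC: he picks a non-limit `i₀ < δ`, written `i₀ = nxt s`, so that the
first stage is `s = i₀ - 1`, and a condition `p` in `M i₀` stronger than `r`. -/
def LegalOpening (B : Board.{u}) (s : WithBot Ordinal.{u}) (p : ZFSet.{u}) : Prop :=
  nxt s < B.δ ∧ p ∈ B.Q.carrier ∧ p ∈ B.M (nxt s) ∧ B.Q.le B.r p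

/-- Legality of the move `P i` of COM at stage `i`, where `q j` are the answers of INC. -/
def LegalCOM (B : Board.{u}) (s : WithBot Ordinal.{u}) (p : ZFSet.{u})
    (P : WithBot Ordinal.{u} → ZFSet.{u}) (q : WithBot Ordinal.{u} → Ordinal.{u} → ZFSet.{u})
    (i : WithBot Ordinal.{u}) : Prop :=
  P i ∈ B.Q.carrier ∧ P i ∈ B.M (nxt i) ∧ B.Q.le p (P i) ∧
    ∀ j, s ≤ j → j < i → ∀ ε < B.d j, B.Q.le (q j ε) (P i)

/-- Legality of the answer `⟨q i ε : ε < d i⟩` of INC to the move `P i` of COM: an increasing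
sequence above `P i` which is `(⟨N i (α + ε) : ε ≤ d i⟩, Q)^n`-generic for some `α < d i` and
some `n`. -/
def LegalINC (B : Board.{u}) (P : WithBot Ordinal.{u} → ZFSet.{u})
    (q : WithBot Ordinal.{u} → Ordinal.{u} → ZFSet.{u}) (i : WithBot Ordinal.{u}) : Prop :=
  B.Q.IsIncreasing (q i) (B.d i) ∧ B.Q.le (P i) (q i 0) ∧
    ∃ α < B.d i, ∃ n : ℕ, B.Q.IsGeneric (fun ε => B.N i (α + ε)) (B.d i) (q i) n

/-- A strategy of INC: his opening, and his answer at stage `i` as a function of the moves of COM at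
the stages in `[start, i]`. -/
structure StrategyINC : Type (u + 1) where
  start : WithBot Ordinal.{u}
  opening : ZFSet.{u}
  answer : (WithBot Ordinal.{u} → ZFSet.{u}) → WithBot Ordinal.{u} → Ordinal.{u} → ZFSet.{u}
  causal : ∀ (P P' : WithBot Ordinal.{u} → ZFSet.{u}) (i : WithBot Ordinal.{u}),
    (∀ j, start ≤ j → j ≤ i → P j = P' j) → answer P i = answer P' i

/-- The strategy is winning: it always prescribes legal moves, and there is no play against it in
which COM makes legal moves at all stages and his moves have an upper bound. -/
def StrategyINC.IsWinning (σ : StrategyINC.{u}) (B : Board.{u}) : Prop :=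
  LegalOpening B σ.start σ.opening ∧
  (∀ (P : WithBot Ordinal.{u} → ZFSet.{u}) (i : WithBot Ordinal.{u}),
    σ.start ≤ i → i < (B.δ : WithBot Ordinal.{u}) →
    (∀ j, σ.start ≤ j → j ≤ i → LegalCOM B σ.start σ.opening P (σ.answer P) j) →
    LegalINC B P (σ.answer P) i) ∧
  ¬ ∃ P : WithBot Ordinal.{u} → ZFSet.{u},
    (∀ i, σ.start ≤ i → i < (B.δ : WithBot Ordinal.{u}) →
      LegalCOM B σ.start σ.opening P (σ.answer P) i) ∧
    ∃ b ∈ B.Q.carrier, ∀ i, σ.start ≤ i → i < (B.δ : WithBot Ordinal.{u}) → B.Q.le (P i) b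

end Game

/-- `Q` is complete for the pair `(E₀, E₁)`. -/
def ForcingNotion.CompleteForPair (Q : ForcingNotion.{u}) (κ μ : Cardinal.{u})
    (E₀ E₁ : Set SetSeq.{u}) : Prop :=
  Q.StronglyCompleteFor κ μ E₀ ∧
  ∃ χ₀ : Cardinal.{u}, ∀ χ : Cardinal.{u}, χ₀ ≤ χ → χ.IsRegular →
    ∀ W : H χ → H χ → Prop, IsWellOrder (H χ) W →
      ∃ x : ZFSet.{u}, InH χ x ∧
        ∀ (M : Ordinal.{u} → ZFSet.{u}) (δ : Ordinal.{u})
          (N : WithBot Ordinal.{u} → Ordinal.{u} → ZFSet.{u})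
          (d : WithBot Ordinal.{u} → Ordinal.{u}),
          IsRuledBy κ μ χ W E₀ E₁ M δ N d → x ∈ M 0 →
          ∀ r ∈ Q.carrier, r ∈ M 0 →
            ¬ ∃ σ : Game.StrategyINC.{u}, σ.IsWinning ⟨Q, M, δ, N, d, r⟩

/-! ### Clubs, stationary sets and the standing hypothesis -/

/-- `E` is a club subset of the ordinal `o`. -/
def IsClubIn (E : Set Ordinal.{u}) (o : Ordinal.{u}) : Prop :=
  E ⊆ Set.Iio o ∧ IsClub {x : Set.Iio o | (x : Ordinal.{u}) ∈ E}

/-- `T ∩ o` is a stationary subset of the ordinal `o`. -/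
def IsStationaryIn (T : Set Ordinal.{u}) (o : Ordinal.{u}) : Prop :=
  IsStationary {x : Set.Iio o | (x : Ordinal.{u}) ∈ T}

/-- `S` does not reflect: no `S ∩ α`, for `α < κ` of uncountable cofinality, is stationary. -/
def NonReflecting (κ : Cardinal.{u}) (S : Set Ordinal.{u}) : Prop :=
  ∀ α < κ.ord, ℵ₀ < α.cof → ¬ IsStationaryIn S α

/-- `⟨e i : i < ρ⟩` is the increasing enumeration of `C`; in particular `ρ` is the order type
of `C`. -/
def IsEnumeration (C : Set Ordinal.{u}) (ρ : Ordinal.{u}) (e : Ordinal.{u} → Ordinal.{u}) : Prop :=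
  StrictMonoOn e (Set.Iio ρ) ∧ e '' Set.Iio ρ = C

/-- The accumulation points of `C` in `C`. -/
def acc (C : Set Ordinal.{u}) : Set Ordinal.{u} :=
  {α | α ∈ C ∧ α ≠ 0 ∧ ∀ β < α, ∃ γ ∈ C, β < γ ∧ γ < α}

/-- The points of `C` that are not accumulation points of `C`. -/
def nacc (C : Set Ordinal.{u}) : Set Ordinal.{u} := C \ acc C

/-- `f` is increasing and continuous on the initial segment `I` of the ordinals. -/
def IsIncreasingContinuousOn (f : Ordinal.{u} → Ordinal.{u}) (I : Set Ordinal.{u}) : Prop :=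
  StrictMonoOn f I ∧ ∀ i ∈ I, IsSuccLimit i → IsLUB (f '' Set.Iio i) (f i)

/-- The standing hypothesis on `κ`, `S` and `⟨C δ : δ ∈ S⟩`. -/
structure StandingHypothesis (κ : Cardinal.{u}) (S : Set Ordinal.{u})
    (C : Ordinal.{u} → Set Ordinal.{u}) : Prop where
  inaccessible : κ.IsInaccessible
  subset : S ⊆ Set.Iio κ.ord
  stationary : IsStationaryIn S κ.ord
  club : ∀ δ ∈ S, IsClubIn (C δ) δ
  otp_lt : ∀ δ ∈ S, ∃ ρ e, IsEnumeration (C δ) ρ e ∧ ρ < δ ∧ ∀ c ∈ C δ, ρ < c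
  nacc_notMem : ∀ δ ∈ S, ∀ α ∈ nacc (C δ), α ∉ S
  nacc_cof : ∀ δ ∈ S, ∀ α ∈ nacc (C δ), ∀ β, IsGreatest (C δ ∩ Set.Iio α) β →
    (2 : Cardinal.{u}) ^ β.card < α.cof
  nacc_not_stationary : ∀ δ ∈ S, ∀ α ∈ nacc (C δ), ¬ IsStationaryIn S α
  acc_coherent : ∀ δ ∈ S, ∀ α ∈ acc (C δ), α ∈ S → C α = C δ ∩ Set.Iio α
  guesses : ∀ E, IsClubIn E κ.ord → IsStationaryIn {δ | δ ∈ S ∧ C δ ⊆ E} κ.ord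
  fat_compl : ∀ E, IsClubIn E κ.ord → ∀ ζ < κ.ord, ∃ e : Ordinal.{u} → Ordinal.{u},
    IsIncreasingContinuousOn e (Set.Iio ζ) ∧ ∀ i < ζ, e i ∈ E ∧ e i ∉ S

/-- The family of all increasing continuous sequences `⟨α_i : i ≤ γ⟩`, `γ < κ`, of ordinals from
`κ \ S`. -/
def family₀ (κ : Cardinal.{u}) (S : Set Ordinal.{u}) : Set SetSeq.{u} :=
  {a | a.last < κ.ord ∧ ∃ f : Ordinal.{u} → Ordinal.{u},
    IsIncreasingContinuousOn f (Set.Iic a.last) ∧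
    ∀ i ≤ a.last, f i < κ.ord ∧ f i ∉ S ∧ a.val i = (f i).toZFSet}

/-- The family of all (nonempty) end segments of the sequences obtained from the increasing
enumeration of `C δ` by adding `δ` at the end, for `δ ∈ S`. -/
def family₁ (S : Set Ordinal.{u}) (C : Ordinal.{u} → Set Ordinal.{u}) : Set SetSeq.{u} :=
  {a | ∃ δ ∈ S, ∃ ρ e, IsEnumeration (C δ) ρ e ∧ ∃ η, η + a.last = ρ ∧
    (∀ i < a.last, a.val i = (e (η + i)).toZFSet) ∧ a.val a.last = δ.toZFSet}

/-! ### The uniformization forcing -/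

/-- The requirements on `⟨A δ : δ ∈ S⟩`, `⟨h δ : δ ∈ S⟩` and `θ`. -/
structure IsUniformizationData (κ : Cardinal.{u}) (S : Set Ordinal.{u}) (θ : Cardinal.{u})
    (A : Ordinal.{u} → Set Ordinal.{u}) (h : Ordinal.{u} → Ordinal.{u} → Ordinal.{u}) : Prop where
  regular : θ.IsRegular
  lt : θ < κ
  subset : ∀ δ ∈ S, A δ ⊆ Set.Iio δ
  card_lt : ∀ δ ∈ S, #(A δ) < Cardinal.lift.{u + 1} θ
  val_lt : ∀ δ ∈ S, ∀ ξ ∈ A δ, h δ ξ < θ.ord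
  isLUB : ∀ δ ∈ S, IsLUB (A δ) δ

/-- `g` is a function from some `β < κ` to `θ` such that, for each `δ ∈ S` with `δ ≤ β`, the set of
those `ξ ∈ A δ` at which `g` and `h δ` differ is bounded in `δ`. -/
def IsUnifCondition (κ : Cardinal.{u}) (S : Set Ordinal.{u}) (θ : Cardinal.{u})
    (A : Ordinal.{u} → Set Ordinal.{u}) (h : Ordinal.{u} → Ordinal.{u} → Ordinal.{u})
    (g : ZFSet.{u}) : Prop :=
  ∃ β < κ.ord, ZFSet.IsFunc β.toZFSet θ.ord.toZFSet g ∧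
    ∀ δ ∈ S, δ ≤ β → ∃ γ < δ, ∀ ξ ∈ A δ,
      ZFSet.pair ξ.toZFSet (h δ ξ).toZFSet ∉ g → ξ < γ

/-- The uniformization forcing, ordered by inclusion. -/
noncomputable def unifForcing (κ : Cardinal.{u}) (S : Set Ordinal.{u}) (θ : Cardinal.{u})
    (A : Ordinal.{u} → Set Ordinal.{u}) (h : Ordinal.{u} → Ordinal.{u} → Ordinal.{u}) :
    ForcingNotion.{u} where
  carrier := ZFSet.sep (IsUnifCondition κ S θ A h)
    (ZFSet.powerset (ZFSet.prod κ.ord.toZFSet θ.ord.toZFSet))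
  le := fun p q => p ⊆ q
  le_refl := fun _ _ _ hz => hz
  le_trans := fun _ _ _ _ _ _ hpq hqr _ hz => hqr (hpq hz)

/-- The set of all conditions of the uniformization forcing with `α` in their domain. -/
noncomputable def unifDomainSet (κ : Cardinal.{u}) (S : Set Ordinal.{u}) (θ : Cardinal.{u})
    (A : Ordinal.{u} → Set Ordinal.{u}) (h : Ordinal.{u} → Ordinal.{u} → Ordinal.{u})
    (α : Ordinal.{u}) : ZFSet.{u} :=
  ZFSet.sep (fun g => ∃ y, ZFSet.pair α.toZFSet y ∈ g) (unifForcing κ S θ A h).carrier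

/-- The members of `carrier` are exactly the functions described by `IsUnifCondition`. -/
theorem mem_unifForcing_carrier {κ : Cardinal.{u}} {S : Set Ordinal.{u}} {θ : Cardinal.{u}}
    {A : Ordinal.{u} → Set Ordinal.{u}} {h : Ordinal.{u} → Ordinal.{u} → Ordinal.{u}}
    {g : ZFSet.{u}} :
    g ∈ (unifForcing κ S θ A h).carrier ↔ IsUnifCondition κ S θ A h g := by
  simp only [unifForcing, ZFSet.mem_sep, ZFSet.mem_powerset, and_iff_right_iff_imp]
  rintro ⟨β, hβ, hg, -⟩ z hz
  obtain ⟨a, ha, b, hb, rfl⟩ := ZFSet.mem_prod.1 (hg.1 hz)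
  exact ZFSet.pair_mem_prod.2 ⟨Ordinal.toZFSet_subset_toZFSet_iff.2 hβ.le ha, hb⟩

end UnifForcing

namespace UnifForcing

open FirstOrder FirstOrder.Language

/-! ### Elementary submodels of `H(χ)` -/

/-! The union of a chain of conditions whose domains converge to `β` can fail to be a condition only
because of `β` itself: a requirement at a smaller `δ ∈ S` is met by any member whose domain passes
`δ` (`exists_union_mem`). So the whole matter is to control limits that lie in `S`.

Along `family₀` such limits do not occur. Genericity makes the domains converge to `N_γ ∩ κ`, an
ordinal off `S`, so the union is a bound (`completeFor_family₀`). For distributivity a chain is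
steered along a closed sequence inside a club and off `S`; the club consists of closure points of a
function bounding the domains of the deciding extensions, which exists because fewer than `κ`
conditions have domain at most a given `β < κ` (`addsNoNewSequences`).

In the game the traces at limit stages may lie in `S`. COM fixes at the outset one condition `g`
with `tr δ` in its domain. Being a condition, `g` already agrees with `h α` on a tail of `A α` for
every `α ∈ S` up to `tr δ`, so it suffices to copy `g` on the relevant ladders. These are the sets
`A (tr k)` with `tr k ∈ S`; their union has size at most `|M i|`, which is below the cofinality of
the approximation of `M (i + 1)`, hence it is bounded below `tr (i + 1)` by some `ρ`
(`IsRuledBy.exists_bound`). At stage `i` COM takes the union of the play, which has domain `tr i`,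
and copies `g` up to `ρ`. The result lies in `M (i + 1)`, which contains every condition with domain
below its trace (`IsElemSub.cond_mem`). INC then decides values only where no relevant ladder has
points. At a limit in `S`, and finally at `tr δ`, the union agrees with `g`, hence with `h`, on a
tail of the ladder (`exists_bound_of_faithful`, `not_isWinning`).

Density without reflection is an induction on the target domain (`exists_extension`): at a limit,
conditions are glued along an unbounded set with no accumulation point in `S` below that limit. -/

theorem InH.mem {χ : Cardinal.{u}} {x y : ZFSet.{u}} (h : InH χ x) (hy : y ∈ x) : InH χ y :=
  ZFSet.Hereditarily.mem h hy

theorem inH_iff {χ : Cardinal.{u}} {x : ZFSet.{u}} :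
    InH χ x ↔ x.card < χ ∧ ∀ y ∈ x, InH χ y :=
  ZFSet.hereditarily_iff

/-- Every set belongs to `H(χ)` for all large enough `χ`. -/
theorem exists_forall_inH (x : ZFSet.{u}) : ∃ χ₀ : Cardinal.{u}, ∀ χ, χ₀ ≤ χ → InH χ x := by
  induction x using ZFSet.inductionOn with
  | _ x ih =>
    choose! f hf using ih
    refine ⟨max (succ x.card) (⨆ y : Shrink.{u} x, f ((equivShrink x).symm y)), fun χ hχ => ?_⟩
    rw [inH_iff]
    refine ⟨succ_le_iff.1 ((le_max_left _ _).trans hχ), fun y hy => hf y hy χ ?_⟩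
    have := le_ciSup (f := fun y : Shrink.{u} x => f ((equivShrink x).symm y))
      (bddAbove_of_small) (equivShrink x ⟨y, hy⟩)
    simp only [Equiv.symm_apply_apply] at this
    exact this.trans ((le_max_right _ _).trans hχ)

theorem inH_pair {χ : Cardinal.{u}} (hχ : ℵ₀ ≤ χ) {x y : ZFSet.{u}} (hx : InH χ x)
    (hy : InH χ y) : InH χ {x, y} := by
  rw [inH_iff]
  refine ⟨lt_of_lt_of_le ?_ hχ, fun z hz => ?_⟩
  · refine (ZFSet.card_insert_le).trans_lt ?_
    rw [ZFSet.card_singleton, one_add_one_eq_two]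
    exact Cardinal.ofNat_lt_aleph0
  · rcases ZFSet.mem_pair.1 hz with rfl | rfl <;> assumption

/-- Lifting of variables under a quantifier. -/
def liftVar {α : Type} {n : ℕ} : α ⊕ Fin n → α ⊕ Fin (n + 1) := Sum.map id Fin.castSucc

/-- The atomic formula `a ∈ b`. -/
def memForm {α : Type} {n : ℕ} (a b : α ⊕ Fin n) : HLang.BoundedFormula α n :=
  BoundedFormula.rel (l := 2) HRel.mem ![Term.var a, Term.var b]

/-- The formula `t = {z, w}`. -/
def upairForm {α : Type} {n : ℕ} (t z w : α ⊕ Fin n) : HLang.BoundedFormula α n :=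
  BoundedFormula.all <| (memForm (Sum.inr (Fin.last n)) (liftVar t)).iff
    (((Term.var (Sum.inr (Fin.last n))).bdEqual (Term.var (liftVar z))) ⊔
      ((Term.var (Sum.inr (Fin.last n))).bdEqual (Term.var (liftVar w))))

/-- The formula `u = (z, w)`. -/
def pairForm {α : Type} {n : ℕ} (u z w : α ⊕ Fin n) : HLang.BoundedFormula α n :=
  BoundedFormula.all <| (memForm (Sum.inr (Fin.last n)) (liftVar u)).iff
    (upairForm (Sum.inr (Fin.last n)) (liftVar z) (liftVar z) ⊔
      upairForm (Sum.inr (Fin.last n)) (liftVar z) (liftVar w))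

/-! ### Absoluteness of pairing: the formulas mean in `H(χ)` what they mean in the universe. -/

section Realize

variable {χ : Cardinal.{u}} {W : H χ → H χ → Prop} {α : Type} {n : ℕ}

theorem elim_liftVar {M : Type*} (v : α → M) (xs : Fin n → M) (a : M) (i : α ⊕ Fin n) :
    Sum.elim v (Fin.snoc xs a : Fin (n + 1) → M) (liftVar i) = Sum.elim v xs i := by
  rcases i with i | i <;> simp [liftVar]

theorem realize_memForm (a b : α ⊕ Fin n) (v : α → H χ) (xs : Fin n → H χ) :
    letI := HStruct χ W
    (memForm a b).Realize v xs ↔ (Sum.elim v xs a).1 ∈ (Sum.elim v xs b).1 := Iff.rfl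

/-- Quantifying over `H(χ)` loses nothing because `H(χ)` is transitive: every member of `t` is
already in it. -/
theorem realize_upairForm (t z w : α ⊕ Fin n) (v : α → H χ) (xs : Fin n → H χ) :
    letI := HStruct χ W
    (upairForm t z w).Realize v xs ↔
      (Sum.elim v xs t).1 = {(Sum.elim v xs z).1, (Sum.elim v xs w).1} := by
  let _ := HStruct χ W
  simp only [upairForm, BoundedFormula.realize_all, BoundedFormula.realize_iff,
    BoundedFormula.realize_sup, BoundedFormula.realize_bdEqual, realize_memForm, elim_liftVar,
    Term.realize_var, Sum.elim_inr, Fin.snoc_last]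
  constructor
  · intro h
    ext s
    rw [ZFSet.mem_pair]
    constructor
    · intro hs
      have := (h ⟨s, (Sum.elim v xs t).2.mem hs⟩).1 hs
      exact this.imp (congrArg Subtype.val) (congrArg Subtype.val)
    · rintro (rfl | rfl)
      · exact (h (Sum.elim v xs z)).2 (Or.inl rfl)
      · exact (h (Sum.elim v xs w)).2 (Or.inr rfl)
  · intro h s
    rw [h, ZFSet.mem_pair]
    exact or_congr Subtype.ext_iff.symm Subtype.ext_iff.symm

/-- Besides transitivity this needs `{z}` and `{z, w}` to belong to `H(χ)`, which is where `ℵ₀ ≤ χ`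
enters. -/
theorem realize_pairForm (hχ : ℵ₀ ≤ χ) (t z w : α ⊕ Fin n) (v : α → H χ) (xs : Fin n → H χ) :
    letI := HStruct χ W
    (pairForm t z w).Realize v xs ↔
      (Sum.elim v xs t).1 = ZFSet.pair (Sum.elim v xs z).1 (Sum.elim v xs w).1 := by
  let _ := HStruct χ W
  simp only [pairForm, BoundedFormula.realize_all, BoundedFormula.realize_iff,
    BoundedFormula.realize_sup, realize_upairForm, realize_memForm, elim_liftVar,
    Sum.elim_inr, Fin.snoc_last, ZFSet.pair_eq_singleton]
  constructor
  · intro h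
    ext s
    rw [ZFSet.pair, ZFSet.mem_pair]
    constructor
    · intro hs
      exact (h ⟨s, (Sum.elim v xs t).2.mem hs⟩).1 hs
    · rintro (rfl | rfl)
      · refine (h ⟨_, ?_⟩).2 (Or.inl rfl)
        rw [← ZFSet.pair_eq_singleton]
        exact inH_pair hχ (Sum.elim v xs z).2 (Sum.elim v xs z).2
      · exact (h ⟨_, inH_pair hχ (Sum.elim v xs z).2 (Sum.elim v xs w).2⟩).2 (Or.inr rfl)
  · intro h s
    rw [h, ZFSet.pair, ZFSet.mem_pair]

end Realize

/-- One direction of the Tarski–Vaught test. It is applied to formulas with a unique solution, so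
that the witness found inside the submodel must be the intended object. -/
theorem _root_.FirstOrder.Language.ElementarySubstructure.exists_mem_realize
    {L : FirstOrder.Language} {M : Type*} [L.Structure M] (E : L.ElementarySubstructure M)
    {α : Type} (φ : L.BoundedFormula α 1) (v : α → M) (hv : ∀ i, v i ∈ E)
    (h : ∃ a : M, φ.Realize v ![a]) : ∃ a ∈ E, φ.Realize v ![a] := by
  let v' : α → E := fun i => ⟨v i, hv i⟩
  have hv' : E.subtype ∘ v' = v := rfl
  have hs : ∀ (y : Fin 0 → M) (a : M), (Fin.snoc y a : Fin 1 → M) = ![a] := by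
    intro y a; ext i
    obtain rfl : i = Fin.last 0 := Subsingleton.elim (α := Fin 1) _ _
    rw [Fin.snoc_last]; rfl
  have h1 : φ.ex.Realize (E.subtype ∘ v') (E.subtype ∘ default) := by
    obtain ⟨a, ha⟩ := h
    refine BoundedFormula.realize_ex.2 ⟨a, ?_⟩
    rwa [hs, hv']
  rw [E.subtype.map_boundedFormula] at h1
  obtain ⟨a, ha⟩ := BoundedFormula.realize_ex.1 h1
  refine ⟨a, a.2, ?_⟩
  rw [← E.subtype.map_boundedFormula, hv'] at ha
  convert ha using 1
  ext i
  obtain rfl : i = Fin.last 0 := Subsingleton.elim (α := Fin 1) _ _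
  change (a : M) = ((Fin.snoc default a : Fin 1 → E) (Fin.last 0) : M)
  rw [Fin.snoc_last]

namespace IsElemSub

variable {χ : Cardinal.{u}} {W : H χ → H χ → Prop} {N : ZFSet.{u}}

theorem inH (hN : IsElemSub χ W N) {x : ZFSet.{u}} (hx : x ∈ N) : InH χ x := by
  obtain ⟨E, hE⟩ := hN
  exact ((hE x).1 hx).1

theorem fst_mem (hχ : ℵ₀ ≤ χ) (hN : IsElemSub χ W N) {a b : ZFSet.{u}}
    (h : ZFSet.pair a b ∈ N) : a ∈ N := by
  obtain ⟨E, hE⟩ := hN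
  let _ := HStruct χ W
  obtain ⟨hx, hxE⟩ := (hE _).1 h
  have ha' : InH χ {a} := hx.mem (by simp [ZFSet.pair])
  have hab' : InH χ {a, b} := hx.mem (by simp [ZFSet.pair])
  have ha : InH χ a := ha'.mem (by simp)
  have hb : InH χ b := hab'.mem (by simp)
  let φ : HLang.BoundedFormula (Fin 1) 1 :=
    BoundedFormula.ex (pairForm (Sum.inl 0) (Sum.inr 0) (Sum.inr 1))
  have key : ∀ c : H χ, φ.Realize ![⟨_, hx⟩] ![c] ↔
      ∃ d : H χ, ZFSet.pair a b = ZFSet.pair c.1 d.1 := by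
    intro c
    simp only [φ, BoundedFormula.realize_ex, realize_pairForm hχ]
    rfl
  obtain ⟨c, hc, hc'⟩ := E.exists_mem_realize φ ![⟨_, hx⟩]
    (by intro i; fin_cases i; exact hxE) ⟨⟨a, ha⟩, (key _).2 ⟨⟨b, hb⟩, rfl⟩⟩
  obtain ⟨d, hd⟩ := (key c).1 hc'
  obtain ⟨rfl, -⟩ := ZFSet.pair_inj.1 hd
  exact (hE _).2 ⟨c.2, hc⟩

theorem snd_mem (hχ : ℵ₀ ≤ χ) (hN : IsElemSub χ W N) {a b : ZFSet.{u}}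
    (h : ZFSet.pair a b ∈ N) : b ∈ N := by
  obtain ⟨E, hE⟩ := hN
  let _ := HStruct χ W
  obtain ⟨hx, hxE⟩ := (hE _).1 h
  have hab' : InH χ {a, b} := hx.mem (by simp [ZFSet.pair])
  have ha : InH χ a := hab'.mem (by simp)
  have hb : InH χ b := hab'.mem (by simp)
  let φ : HLang.BoundedFormula (Fin 1) 1 :=
    BoundedFormula.ex (pairForm (Sum.inl 0) (Sum.inr 1) (Sum.inr 0))
  have key : ∀ c : H χ, φ.Realize ![⟨_, hx⟩] ![c] ↔
      ∃ d : H χ, ZFSet.pair a b = ZFSet.pair d.1 c.1 := by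
    intro c
    simp only [φ, BoundedFormula.realize_ex, realize_pairForm hχ]
    rfl
  obtain ⟨c, hc, hc'⟩ := E.exists_mem_realize φ ![⟨_, hx⟩]
    (by intro i; fin_cases i; exact hxE) ⟨⟨b, hb⟩, (key _).2 ⟨⟨a, ha⟩, rfl⟩⟩
  obtain ⟨d, hd⟩ := (key c).1 hc'
  obtain ⟨-, rfl⟩ := ZFSet.pair_inj.1 hd
  exact (hE _).2 ⟨c.2, hc⟩

/-- An elementary submodel is closed under the application of functions which belong to it. -/
theorem apply_mem (hχ : ℵ₀ ≤ χ) (hN : IsElemSub χ W N) {F a b : ZFSet.{u}}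
    (hF : F ∈ N) (ha : a ∈ N) (hab : ZFSet.pair a b ∈ F)
    (huniq : ∀ c, ZFSet.pair a c ∈ F → c = b) : b ∈ N := by
  have hx : InH χ (ZFSet.pair a b) := (hN.inH hF).mem hab
  obtain ⟨E, hE⟩ := hN
  let _ := HStruct χ W
  obtain ⟨hFH, hFE⟩ := (hE _).1 hF
  obtain ⟨haH, haE⟩ := (hE _).1 ha
  have hab' : InH χ {a, b} := hx.mem (by simp [ZFSet.pair])
  have hb : InH χ b := hab'.mem (by simp)
  let φ : HLang.BoundedFormula (Fin 2) 1 :=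
    BoundedFormula.ex (memForm (Sum.inr 1) (Sum.inl 0) ⊓
      pairForm (Sum.inr 1) (Sum.inl 1) (Sum.inr 0))
  have key : ∀ c : H χ, φ.Realize ![⟨_, hFH⟩, ⟨_, haH⟩] ![c] ↔
      ∃ d : H χ, d.1 ∈ F ∧ d.1 = ZFSet.pair a c.1 := by
    intro c
    simp only [φ, BoundedFormula.realize_ex, BoundedFormula.realize_inf, realize_memForm,
      realize_pairForm hχ]
    rfl
  obtain ⟨c, hc, hc'⟩ := E.exists_mem_realize φ ![⟨_, hFH⟩, ⟨_, haH⟩]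
    (by intro i; fin_cases i; exacts [hFE, haE]) ⟨⟨b, hb⟩, (key _).2 ⟨⟨_, hx⟩, hab, rfl⟩⟩
  obtain ⟨d, hd, hd'⟩ := (key c).1 hc'
  rw [hd'] at hd
  rw [← huniq _ hd]
  exact (hE _).2 ⟨c.2, hc⟩

end IsElemSub

/-! ### Conditions of the uniformization forcing as functions on ordinals -/

theorem mem_seqCode {f : Ordinal.{u} → ZFSet.{u}} {o : Ordinal.{u}} {z : ZFSet.{u}} :
    z ∈ seqCode f o ↔ ∃ j < o, ZFSet.pair j.toZFSet (f j) = z := by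
  simp [seqCode]

theorem pair_mem_seqCode {f : Ordinal.{u} → ZFSet.{u}} {o j : Ordinal.{u}} {y : ZFSet.{u}} :
    ZFSet.pair j.toZFSet y ∈ seqCode f o ↔ j < o ∧ y = f j := by
  rw [mem_seqCode]
  constructor
  · rintro ⟨i, hi, h⟩
    obtain ⟨h1, rfl⟩ := ZFSet.pair_inj.1 h
    obtain rfl := Ordinal.toZFSet_injective h1
    exact ⟨hi, rfl⟩
  · rintro ⟨hj, rfl⟩
    exact ⟨j, hj, rfl⟩

/-- The restriction of `f` to `β`, as a set. -/
noncomputable def graph (f : Ordinal.{u} → Ordinal.{u}) (β : Ordinal.{u}) : ZFSet.{u} :=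
  seqCode (fun ξ => (f ξ).toZFSet) β

theorem pair_mem_graph {f : Ordinal.{u} → Ordinal.{u}} {β ξ y : Ordinal.{u}} :
    ZFSet.pair ξ.toZFSet y.toZFSet ∈ graph f β ↔ ξ < β ∧ y = f ξ := by
  rw [graph, pair_mem_seqCode, Ordinal.toZFSet_injective.eq_iff]

theorem graph_subset_iff {f f' : Ordinal.{u} → Ordinal.{u}} {β β' : Ordinal.{u}} :
    graph f β ⊆ graph f' β' ↔ β ≤ β' ∧ ∀ ξ < β, f ξ = f' ξ := by
  constructor
  · intro h
    have key : ∀ ξ < β, ξ < β' ∧ f ξ = f' ξ := fun ξ hξ =>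
      pair_mem_graph.1 (h (pair_mem_graph.2 ⟨hξ, rfl⟩))
    exact ⟨le_of_forall_lt fun ξ hξ => (key ξ hξ).1, fun ξ hξ => (key ξ hξ).2⟩
  · rintro ⟨hle, h⟩ z hz
    obtain ⟨ξ, hξ, rfl⟩ := mem_seqCode.1 hz
    exact pair_mem_graph.2 ⟨hξ.trans_le hle, h ξ hξ⟩

/-- The domain of the function `g`, if this domain is an ordinal. -/
noncomputable def domOf (g : ZFSet.{u}) : Ordinal.{u} :=
  Classical.epsilon fun β => ∃ f, g = graph f β

/-- The function on the ordinals coded by `g`. -/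
noncomputable def fnOf (g : ZFSet.{u}) : Ordinal.{u} → Ordinal.{u} :=
  Classical.epsilon fun f => g = graph f (domOf g)

theorem graph_fnOf {g : ZFSet.{u}} (hg : ∃ β f, g = graph f β) : graph (fnOf g) (domOf g) = g := by
  have h1 : ∃ f, g = graph f (domOf g) := Classical.epsilon_spec hg
  exact (Classical.epsilon_spec h1).symm

theorem domOf_graph (f : Ordinal.{u} → Ordinal.{u}) (β : Ordinal.{u}) :
    domOf (graph f β) = β := by
  have h := graph_fnOf (g := graph f β) ⟨β, f, rfl⟩
  exact le_antisymm (graph_subset_iff.1 h.le).1 (graph_subset_iff.1 h.ge).1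

/-- The restriction to `ξ < β` is essential: the chosen function is determined by its graph only
below the domain, and its other values are junk. -/
theorem fnOf_graph (f : Ordinal.{u} → Ordinal.{u}) {β ξ : Ordinal.{u}} (hξ : ξ < β) :
    fnOf (graph f β) ξ = f ξ := by
  have h := graph_fnOf (g := graph f β) ⟨β, f, rfl⟩
  exact ((graph_subset_iff.1 h.ge).2 ξ hξ).symm

/-- The function `f` restricted to `β` is a condition. -/
structure IsGood (κ : Cardinal.{u}) (S : Set Ordinal.{u}) (θ : Cardinal.{u})
    (A : Ordinal.{u} → Set Ordinal.{u}) (h : Ordinal.{u} → Ordinal.{u} → Ordinal.{u})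
    (β : Ordinal.{u}) (f : Ordinal.{u} → Ordinal.{u}) : Prop where
  lt : β < κ.ord
  val : ∀ ξ < β, f ξ < θ.ord
  agree : ∀ δ ∈ S, δ ≤ β → ∃ γ < δ, ∀ ξ ∈ A δ, γ ≤ ξ → f ξ = h δ ξ

section Conditions

variable {κ θ : Cardinal.{u}} {S : Set Ordinal.{u}} {A : Ordinal.{u} → Set Ordinal.{u}}
  {h : Ordinal.{u} → Ordinal.{u} → Ordinal.{u}}

/-- Since `A δ ⊆ δ`, the requirements at `δ ≤ β` only see values below `β`; junk values of `fnOf`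
therefore do no harm. -/
theorem IsGood.congr (hA : ∀ δ ∈ S, A δ ⊆ Set.Iio δ) {β : Ordinal.{u}}
    {f f' : Ordinal.{u} → Ordinal.{u}} (hf : IsGood κ S θ A h β f)
    (hff' : ∀ ξ < β, f' ξ = f ξ) : IsGood κ S θ A h β f' where
  lt := hf.lt
  val ξ hξ := by rw [hff' ξ hξ]; exact hf.val ξ hξ
  agree δ hδ hδβ := by
    obtain ⟨γ, hγ, H⟩ := hf.agree δ hδ hδβ
    exact ⟨γ, hγ, fun ξ hξ hγξ => by
      rw [hff' ξ ((hA δ hδ hξ).trans_le hδβ)]; exact H ξ hξ hγξ⟩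

theorem IsGood.graph_mem (hA : ∀ δ ∈ S, A δ ⊆ Set.Iio δ) {β : Ordinal.{u}}
    {f : Ordinal.{u} → Ordinal.{u}} (hf : IsGood κ S θ A h β f) :
    graph f β ∈ (unifForcing κ S θ A h).carrier := by
  rw [mem_unifForcing_carrier]
  refine ⟨β, hf.lt, ⟨?_, ?_⟩, ?_⟩
  · intro z hz
    obtain ⟨ξ, hξ, rfl⟩ := mem_seqCode.1 hz
    exact ZFSet.pair_mem_prod.2 ⟨Ordinal.toZFSet_mem_toZFSet_iff.2 hξ,
      Ordinal.toZFSet_mem_toZFSet_iff.2 (hf.val ξ hξ)⟩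
  · intro z hz
    obtain ⟨ξ, hξ, rfl⟩ := Ordinal.mem_toZFSet_iff.1 hz
    exact ⟨(f ξ).toZFSet, pair_mem_seqCode.2 ⟨hξ, rfl⟩, fun y hy => (pair_mem_seqCode.1 hy).2⟩
  · intro δ hδ hδβ
    obtain ⟨γ, hγ, H⟩ := hf.agree δ hδ hδβ
    refine ⟨γ, hγ, fun ξ hξ hne => ?_⟩
    by_contra! hγξ
    exact hne (pair_mem_graph.2 ⟨(hA δ hδ hξ).trans_le hδβ, (H ξ hξ hγξ).symm⟩)

theorem exists_graph_of_mem {g : ZFSet.{u}} (hg : g ∈ (unifForcing κ S θ A h).carrier) :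
    ∃ β f, IsGood κ S θ A h β f ∧ g = graph f β := by
  rw [mem_unifForcing_carrier] at hg
  obtain ⟨β, hβ, ⟨hsub, hfun⟩, hagree⟩ := hg
  have : ∀ ξ < β, ∃ y < θ.ord, ∀ w, ZFSet.pair ξ.toZFSet w ∈ g ↔ w = y.toZFSet := by
    intro ξ hξ
    obtain ⟨w, hw, hw'⟩ := hfun ξ.toZFSet (Ordinal.toZFSet_mem_toZFSet_iff.2 hξ)
    obtain ⟨-, hwθ⟩ := ZFSet.pair_mem_prod.1 (hsub hw)
    obtain ⟨y, hy, rfl⟩ := Ordinal.mem_toZFSet_iff.1 hwθ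
    exact ⟨y, hy, fun w => ⟨hw' w, fun h => h ▸ hw⟩⟩
  choose! f hf hfg using this
  refine ⟨β, f, ⟨hβ, hf, ?_⟩, ?_⟩
  · intro δ hδ hδβ
    obtain ⟨γ, hγ, H⟩ := hagree δ hδ hδβ
    refine ⟨γ, hγ, fun ξ hξ hγξ => ?_⟩
    by_contra hne
    refine (H ξ hξ fun hmem => hne ?_).not_ge hγξ
    have hξβ : ξ < β := by
      obtain ⟨a, ha, e⟩ := Ordinal.mem_toZFSet_iff.1 (ZFSet.pair_mem_prod.1 (hsub hmem)).1
      exact Ordinal.toZFSet_injective e ▸ ha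
    exact (Ordinal.toZFSet_injective ((hfg ξ hξβ _).1 hmem)).symm
  · ext z
    constructor
    · intro hz
      obtain ⟨a, ha, b, hb, rfl⟩ := ZFSet.mem_prod.1 (hsub hz)
      obtain ⟨ξ, hξ, rfl⟩ := Ordinal.mem_toZFSet_iff.1 ha
      exact pair_mem_seqCode.2 ⟨hξ, (hfg ξ hξ _).1 hz⟩
    · intro hz
      obtain ⟨ξ, hξ, rfl⟩ := mem_seqCode.1 hz
      exact (hfg ξ hξ _).2 rfl

theorem graph_eq_of_mem {g : ZFSet.{u}} (hg : g ∈ (unifForcing κ S θ A h).carrier) :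
    graph (fnOf g) (domOf g) = g := by
  obtain ⟨β, f, -, e⟩ := exists_graph_of_mem hg
  exact graph_fnOf ⟨β, f, e⟩

theorem isGood_of_mem (hA : ∀ δ ∈ S, A δ ⊆ Set.Iio δ) {g : ZFSet.{u}}
    (hg : g ∈ (unifForcing κ S θ A h).carrier) : IsGood κ S θ A h (domOf g) (fnOf g) := by
  obtain ⟨β, f, hf, rfl⟩ := exists_graph_of_mem hg
  rw [domOf_graph]
  exact hf.congr hA fun ξ hξ => fnOf_graph f hξ

theorem subset_iff_of_mem {p q : ZFSet.{u}} (hp : p ∈ (unifForcing κ S θ A h).carrier)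
    (hq : q ∈ (unifForcing κ S θ A h).carrier) :
    p ⊆ q ↔ domOf p ≤ domOf q ∧ ∀ ξ < domOf p, fnOf p ξ = fnOf q ξ := by
  rw [← graph_subset_iff, graph_eq_of_mem hp, graph_eq_of_mem hq]

theorem mem_unifDomainSet {α : Ordinal.{u}} {g : ZFSet.{u}} :
    g ∈ unifDomainSet κ S θ A h α ↔ g ∈ (unifForcing κ S θ A h).carrier ∧ α < domOf g := by
  rw [unifDomainSet, ZFSet.mem_sep]
  refine and_congr_right fun hg => ?_
  rw [← graph_eq_of_mem hg, graph]
  simp only [pair_mem_seqCode, exists_and_left, exists_eq, and_true]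
  rw [← graph, graph_eq_of_mem hg]

/-- The union of a chain of conditions is a condition, provided that it behaves well at its
supremum. -/
theorem exists_union_mem (hA : ∀ δ ∈ S, A δ ⊆ Set.Iio δ) {ι : Type*} (G : ι → ZFSet.{u})
    (hG : ∀ i, G i ∈ (unifForcing κ S θ A h).carrier) (hchain : ∀ i j, G i ⊆ G j ∨ G j ⊆ G i)
    {β : Ordinal.{u}} (hβ : β < κ.ord) (hle : ∀ i, domOf (G i) ≤ β)
    (hcof : ∀ ξ < β, ∃ i, ξ < domOf (G i))
    (hS : β ∈ S → ∃ γ < β, ∀ ξ ∈ A β, γ ≤ ξ → ∃ i, ξ < domOf (G i) ∧ fnOf (G i) ξ = h β ξ) :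
    ∃ q ∈ (unifForcing κ S θ A h).carrier, domOf q = β ∧ ∀ i, G i ⊆ q := by
  classical
  choose k hk using hcof
  have hagree : ∀ i j ξ, ξ < domOf (G i) → ξ < domOf (G j) → fnOf (G i) ξ = fnOf (G j) ξ := by
    intro i j ξ hi hj
    rcases hchain i j with hij | hij
    · exact ((subset_iff_of_mem (hG i) (hG j)).1 hij).2 ξ hi
    · exact (((subset_iff_of_mem (hG j) (hG i)).1 hij).2 ξ hj).symm
  set f : Ordinal.{u} → Ordinal.{u} := fun ξ =>
    if hξ : ξ < β then fnOf (G (k ξ hξ)) ξ else 0 with hf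
  have hfi : ∀ i, ∀ ξ < domOf (G i), f ξ = fnOf (G i) ξ := fun i ξ hξ => by
    have hξβ := hξ.trans_le (hle i)
    rw [hf]
    simp only [dif_pos hξβ]
    exact hagree _ _ _ (hk ξ hξβ) hξ
  have hgood : IsGood κ S θ A h β f := by
    refine ⟨hβ, fun ξ hξ => ?_, fun δ hδ hδβ => ?_⟩
    · rw [hfi _ ξ (hk ξ hξ)]
      exact (isGood_of_mem hA (hG (k ξ hξ))).val ξ (hk ξ hξ)
    rcases hδβ.lt_or_eq with hlt | rfl
    -- A requirement strictly below `β` is inherited from a single member of the chain whose domain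
    -- passes `δ`.
    · obtain ⟨γ, hγ, H⟩ := (isGood_of_mem hA (hG (k δ hlt))).agree δ hδ (hk δ hlt).le
      refine ⟨γ, hγ, fun ξ hξ hγξ => ?_⟩
      rw [hfi (k δ hlt) ξ ((hA δ hδ hξ).trans (hk δ hlt))]
      exact H ξ hξ hγξ
    · obtain ⟨γ, hγ, H⟩ := hS hδ
      refine ⟨γ, hγ, fun ξ hξ hγξ => ?_⟩
      obtain ⟨i, hi, e⟩ := H ξ hξ hγξ
      rw [hfi i ξ hi, e]
  refine ⟨graph f β, hgood.graph_mem hA, domOf_graph f β, fun i => ?_⟩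
  rw [← graph_eq_of_mem (hG i), graph_subset_iff]
  exact ⟨hle i, fun ξ hξ => (hfi i ξ hξ).symm⟩

/-- A condition can be continued by the values of another condition. -/
theorem exists_patch_mem (hA : ∀ δ ∈ S, A δ ⊆ Set.Iio δ) {p g : ZFSet.{u}}
    (hp : p ∈ (unifForcing κ S θ A h).carrier) (hg : g ∈ (unifForcing κ S θ A h).carrier)
    {ρ : Ordinal.{u}} (hpρ : domOf p ≤ ρ) (hρg : ρ ≤ domOf g) :
    ∃ q ∈ (unifForcing κ S θ A h).carrier, domOf q = ρ ∧ p ⊆ q ∧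
      ∀ ξ, domOf p ≤ ξ → ξ < ρ → fnOf q ξ = fnOf g ξ := by
  classical
  have gp := isGood_of_mem hA hp
  have gg := isGood_of_mem hA hg
  set f : Ordinal.{u} → Ordinal.{u} := fun ξ => if ξ < domOf p then fnOf p ξ else fnOf g ξ with hf
  have hfp : ∀ ξ < domOf p, f ξ = fnOf p ξ := fun ξ hξ => if_pos hξ
  have hfg : ∀ ξ, domOf p ≤ ξ → f ξ = fnOf g ξ := fun ξ hξ => if_neg hξ.not_gt
  have hgood : IsGood κ S θ A h ρ f := by
    refine ⟨hρg.trans_lt gg.lt, fun ξ hξ => ?_, fun δ hδ hδρ => ?_⟩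
    · rcases lt_or_ge ξ (domOf p) with hlt | hge
      · rw [hfp ξ hlt]; exact gp.val ξ hlt
      · rw [hfg ξ hge]; exact gg.val ξ (hξ.trans_le hρg)
    · rcases le_or_gt δ (domOf p) with hle | hgt
      · obtain ⟨γ, hγ, H⟩ := gp.agree δ hδ hle
        refine ⟨γ, hγ, fun ξ hξ hγξ => ?_⟩
        rw [hfp ξ ((hA δ hδ hξ).trans_le hle)]
        exact H ξ hξ hγξ
      · obtain ⟨γ, hγ, H⟩ := gg.agree δ hδ (hδρ.trans hρg)
        -- Disagreement with `g` is confined to the domain of `p`, which is bounded in `δ`.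
        refine ⟨max γ (domOf p), max_lt hγ hgt, fun ξ hξ hγξ => ?_⟩
        rw [hfg ξ ((le_max_right _ _).trans hγξ)]
        exact H ξ hξ ((le_max_left _ _).trans hγξ)
  refine ⟨graph f ρ, hgood.graph_mem hA, domOf_graph f ρ, ?_, fun ξ hξ hξρ => ?_⟩
  · rw [← graph_eq_of_mem hp, graph_subset_iff]
    exact ⟨hpρ, fun ξ hξ => (hfp ξ hξ).symm⟩
  · rw [fnOf_graph f hξρ, hfg ξ hξ]

theorem empty_mem_unifForcing (hκ : 0 < κ.ord) (h0 : (0 : Ordinal.{u}) ∉ S) :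
    ∅ ∈ (unifForcing κ S θ A h).carrier := by
  rw [mem_unifForcing_carrier]
  refine ⟨0, hκ, ⟨ZFSet.empty_subset _, fun z hz => ?_⟩, fun δ hδ hδ0 => ?_⟩
  · simp at hz
  · rw [nonpos_iff_eq_zero] at hδ0
    exact absurd (hδ0 ▸ hδ) h0

theorem le_unifForcing {p q : ZFSet.{u}} : (unifForcing κ S θ A h).le p q ↔ p ⊆ q := Iff.rfl

end Conditions

/-! ### Density of the sets of conditions with a given ordinal in the domain -/

section Density

variable {κ θ : Cardinal.{u}} {S : Set Ordinal.{u}} {A : Ordinal.{u} → Set Ordinal.{u}}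
  {C : Ordinal.{u} → Set Ordinal.{u}} {h : Ordinal.{u} → Ordinal.{u} → Ordinal.{u}}

/-- A successor `δ` is impossible because its predecessor would bound `A δ`, whose supremum is `δ`;
zero is excluded by the order type being below `δ`. -/
theorem StandingHypothesis.isSuccLimit (hyp : StandingHypothesis κ S C)
    (data : IsUniformizationData κ S θ A h) {δ : Ordinal.{u}} (hδ : δ ∈ S) : IsSuccLimit δ := by
  obtain ⟨ρ, e, -, hρ, -⟩ := hyp.otp_lt δ hδ
  refine ⟨fun hmin => (pos_of_gt hρ).ne' hmin.eq_bot, isSuccPrelimit_of_succ_lt fun a ha => ?_⟩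
  by_contra! hle
  refine ha.not_ge ((data.isLUB δ hδ).2 fun ξ hξ => ?_)
  exact Order.lt_succ_iff.1 ((data.subset δ hδ hξ).trans_le hle)

theorem StandingHypothesis.zero_notMem (hyp : StandingHypothesis κ S C) : (0 : Ordinal.{u}) ∉ S := by
  intro h0
  obtain ⟨ρ, e, -, hρ, -⟩ := hyp.otp_lt 0 h0
  exact not_lt_zero hρ

/-- If `S ∩ β` is not stationary in `β`, or `β` has countable cofinality, then some unbounded subset
of `β` is bounded below all members of `S ∩ β`. -/
theorem exists_unbounded_avoiding (hlim : ∀ δ ∈ S, IsSuccLimit δ) {β : Ordinal.{u}}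
    (hβ : IsSuccLimit β) (hS : ℵ₀ < β.cof → ¬ IsStationaryIn S β) :
    ∃ E : Set Ordinal.{u}, E ⊆ Set.Iio β ∧ (∀ ξ < β, ∃ e ∈ E, ξ < e) ∧
      ∀ δ ∈ S, δ < β → ∃ c < δ, ∀ e ∈ E, e < δ → e ≤ c := by
  have hβ0 : 0 < β := hβ.bot_lt
  rcases lt_or_ge ℵ₀ β.cof with hcof | hcof
  · obtain ⟨t, ht, hdisj⟩ := not_isStationary_iff.1 (hS hcof)
    refine ⟨Subtype.val '' t, ?_, fun ξ hξ => ?_, fun δ hδ hδβ => ?_⟩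
    · rintro _ ⟨x, -, rfl⟩
      exact x.2
    · obtain ⟨b, hb, hle⟩ := ht.isCofinal ⟨succ ξ, hβ.succ_lt hξ⟩
      exact ⟨b, ⟨b, hb, rfl⟩, Order.succ_le_iff.1 (Subtype.coe_le_coe.2 hle)⟩
    · by_contra! H
      -- If no `c` worked, `δ` would be a limit of the club `t`, hence in `t`, contradicting that
      -- `t` misses `S`.
      have hδt : (⟨δ, hδβ⟩ : Set.Iio β) ∈ t := by
        refine ht.isLUB_mem (t := t ∩ Set.Iio ⟨δ, hδβ⟩) inter_subset_left ?_ ⟨?_, ?_⟩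
        · obtain ⟨_, ⟨x, hx, rfl⟩, hxδ, -⟩ := H 0 (hlim δ hδ).bot_lt
          exact ⟨x, hx, (show x < ⟨δ, hδβ⟩ from hxδ)⟩
        · exact fun x hx => le_of_lt hx.2
        · intro b hb
          by_contra! hlt
          obtain ⟨_, ⟨x, hx, rfl⟩, hxδ, hbx⟩ := H b.1 hlt
          exact (hb (show x ∈ t ∩ Set.Iio ⟨δ, hδβ⟩ from ⟨hx, hxδ⟩)).not_gt hbx
      exact Set.disjoint_left.1 hdisj
        (show (⟨δ, hδβ⟩ : Set.Iio β) ∈ {x : Set.Iio β | (x : Ordinal.{u}) ∈ S} from hδ) hδt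
  · obtain ⟨s, hs, hs'⟩ := Order.exists_cof_eq (Set.Iio β)
    have hne : Nonempty (Set.Iio β) := ⟨⟨0, hβ0⟩⟩
    have hcount : s.Countable := by
      rw [← le_aleph0_iff_set_countable, hs', Ordinal.cof_Iio, ← Ordinal.lift_cof]
      rwa [Cardinal.lift_le_aleph0]
    obtain ⟨f, rfl⟩ := hcount.exists_eq_range hs.nonempty
    -- Partial suprema turn the countable cofinal set into a monotone `ω`-sequence, so only finitely
    -- many of its values lie below a given `δ < β`.
    have hunb : ∀ ξ < β, ∃ n, ξ < (partialSups f n).1 := fun ξ hξ => by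
      obtain ⟨_, ⟨n, rfl⟩, hle⟩ := hs ⟨succ ξ, hβ.succ_lt hξ⟩
      exact ⟨n, Order.succ_le_iff.1 (Subtype.coe_le_coe.2 (hle.trans (le_partialSups f n)))⟩
    refine ⟨Set.range fun n => (partialSups f n).1, ?_, fun ξ hξ => ?_, fun δ hδ hδβ => ?_⟩
    · rintro _ ⟨n, rfl⟩
      exact (partialSups f n).2
    · obtain ⟨n, hn⟩ := hunb ξ hξ
      exact ⟨_, ⟨n, rfl⟩, hn⟩
    · obtain ⟨n, hn⟩ := hunb δ hδβ
      have hδ0 : 0 < δ := (hlim δ hδ).bot_lt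
      refine ⟨(Finset.range n).sup fun k => if (partialSups f k).1 < δ then (partialSups f k).1
        else 0, ?_, ?_⟩
      · rw [Finset.sup_lt_iff (by exact hδ0)]
        intro k _
        split_ifs with hk
        exacts [hk, hδ0]
      · rintro _ ⟨k, rfl⟩ hk
        have hkn : k < n := by
          by_contra! hnk
          exact (hn.trans_le (Subtype.coe_le_coe.2 ((partialSups f).monotone hnk))).not_gt hk
        refine le_trans ?_ (Finset.le_sup (Finset.mem_range.2 hkn))
        rw [if_pos hk]

/-- Under the assumptions of the second half of the main theorem, every condition can be extended to
any larger domain. -/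
theorem exists_extension (hlim : ∀ δ ∈ S, IsSuccLimit δ) (data : IsUniformizationData κ S θ A h)
    (hS : NonReflecting κ S)
    (hbdd : ∀ δ ∈ S, ∀ δ' ∈ S, δ' < δ → ∃ γ < δ', ∀ ξ ∈ A δ, ξ < δ' → ξ < γ)
    {β₀ : Ordinal.{u}} {f₀ : Ordinal.{u} → Ordinal.{u}} (hf₀ : IsGood κ S θ A h β₀ f₀)
    (β : Ordinal.{u}) (hβ : β < κ.ord) (hβ₀ : β₀ ≤ β) :
    ∃ f, IsGood κ S θ A h β f ∧ ∀ ξ < β₀, f ξ = f₀ ξ := by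
  classical
  induction β using WellFoundedLT.induction with
  | _ β ih =>
  rcases hβ₀.eq_or_lt with rfl | hlt
  · exact ⟨f₀, hf₀, fun _ _ => rfl⟩
  -- it suffices to satisfy the requirements below `β`
  suffices H : ∃ u : Ordinal.{u} → Ordinal.{u}, (∀ ξ < β, u ξ < θ.ord) ∧ (∀ ξ < β₀, u ξ = f₀ ξ) ∧
      ∀ δ ∈ S, δ < β → ∃ γ < δ, ∀ ξ ∈ A δ, γ ≤ ξ → u ξ = h δ ξ by
    obtain ⟨u, huθ, hu₀, hu⟩ := H
    by_cases hβS : β ∈ S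
    -- Overwriting on `A β` preserves the earlier requirements, since `A β` is bounded in each
    -- smaller `δ ∈ S`. Doing so only from `β₀` on preserves `f₀`.
    · refine ⟨fun ξ => if ξ ∈ A β ∧ β₀ ≤ ξ then h β ξ else u ξ, ⟨hβ, fun ξ hξ => ?_, ?_⟩, ?_⟩
      · split_ifs with hc
        exacts [data.val_lt β hβS ξ hc.1, huθ ξ hξ]
      · intro δ hδ hδβ
        rcases hδβ.lt_or_eq with hlt' | rfl
        · obtain ⟨γ, hγ, H⟩ := hu δ hδ hlt'
          obtain ⟨γ', hγ', H'⟩ := hbdd β hβS δ hδ hlt'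
          refine ⟨max γ γ', max_lt hγ hγ', fun ξ hξ hle => ?_⟩
          rw [if_neg, H ξ hξ ((le_max_left _ _).trans hle)]
          rintro ⟨hξ', -⟩
          exact (H' ξ hξ' (data.subset δ hδ hξ)).not_ge ((le_max_right _ _).trans hle)
        · exact ⟨β₀, hlt, fun ξ hξ hle => if_pos ⟨hξ, hle⟩⟩
      · intro ξ hξ
        dsimp only
        rw [if_neg (fun hc => hc.2.not_gt hξ), hu₀ ξ hξ]
    · refine ⟨u, ⟨hβ, huθ, fun δ hδ hδβ => hu δ hδ (hδβ.lt_of_ne ?_)⟩, hu₀⟩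
      rintro rfl
      exact hβS hδ
  rcases Ordinal.zero_or_succ_or_isSuccLimit β with rfl | ⟨α, rfl⟩ | hβlim
  · exact absurd hlt not_lt_zero
  · obtain ⟨f, hf, hff₀⟩ := ih α (lt_succ α) ((lt_succ α).trans hβ) (Order.lt_succ_iff.1 hlt)
    refine ⟨fun ξ => if ξ < α then f ξ else 0, fun ξ _ => ?_, fun ξ hξ => ?_, fun δ hδ hδα => ?_⟩
    · dsimp only
      split_ifs with hc
      exacts [hf.val ξ hc, data.regular.ord_pos]
    · dsimp only
      rw [if_pos (hξ.trans_le (Order.lt_succ_iff.1 hlt)), hff₀ ξ hξ]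
    · obtain ⟨γ, hγ, H⟩ := hf.agree δ hδ (Order.lt_succ_iff.1 hδα)
      refine ⟨γ, hγ, fun ξ hξ hle => ?_⟩
      dsimp only
      rw [if_pos ((data.subset δ hδ hξ).trans_le (Order.lt_succ_iff.1 hδα)), H ξ hξ hle]
  · obtain ⟨E, hEβ, hE, hES⟩ := exists_unbounded_avoiding hlim hβlim (hS β hβ)
    choose! g hg hgf₀ using fun γ (hγ : γ < β ∧ β₀ ≤ γ) =>
      ih γ hγ.1 (hγ.1.trans hβ) hγ.2
    -- the least member of `E` above `ξ` and `β₀`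
    let T : Ordinal.{u} → Set Ordinal.{u} := fun ξ => {e | e ∈ E ∧ ξ < e ∧ β₀ ≤ e}
    let n : Ordinal.{u} → Ordinal.{u} := fun ξ => sInf (T ξ)
    have hn : ∀ ξ < β, n ξ ∈ T ξ := fun ξ hξ => by
      obtain ⟨e, he, hlt'⟩ := hE (max ξ β₀) (max_lt hξ hlt)
      exact csInf_mem ⟨e, he, (le_max_left _ _).trans_lt hlt', ((le_max_right _ _).trans_lt hlt').le⟩
    refine ⟨fun ξ => g (n ξ) ξ, fun ξ hξ => ?_, fun ξ hξ => ?_, fun δ hδ hδβ => ?_⟩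
    · exact (hg _ ⟨hEβ (hn ξ hξ).1, (hn ξ hξ).2.2⟩).val ξ (hn ξ hξ).2.1
    · have hξβ := hξ.trans hlt
      exact hgf₀ _ ⟨hEβ (hn ξ hξβ).1, (hn ξ hξβ).2.2⟩ ξ hξ
    · rcases le_or_gt δ β₀ with hle | hgt
      · obtain ⟨γ, hγ, H⟩ := hf₀.agree δ hδ hle
        refine ⟨γ, hγ, fun ξ hξ hγξ => ?_⟩
        have hξβ := (data.subset δ hδ hξ).trans hδβ
        dsimp only
        rw [hgf₀ _ ⟨hEβ (hn ξ hξβ).1, (hn ξ hξβ).2.2⟩ ξ ((data.subset δ hδ hξ).trans_le hle)]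
        exact H ξ hξ hγξ
      · obtain ⟨c, hc, hcE⟩ := hES δ hδ hδβ
        -- the least member of `E` which is at least `δ`
        obtain ⟨m, ⟨hmE, hδm⟩, hmin⟩ : ∃ m, IsLeast {e | e ∈ E ∧ δ ≤ e} m := by
          obtain ⟨e, he, hlt'⟩ := hE δ hδβ
          exact ⟨_, csInf_mem (⟨e, he, hlt'.le⟩ : {e | e ∈ E ∧ δ ≤ e}.Nonempty),
            fun x hx => csInf_le' hx⟩
        -- No point of `E` lies strictly between `c` and `δ`, so on this tail of `δ` the glued
        -- function copies the single condition `g m`, which meets the requirement at `δ`.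
        have hnm : ∀ ξ, c ≤ ξ → ξ < δ → n ξ = m := fun ξ hcξ hξδ => by
          have hξ' := hn ξ (hξδ.trans hδβ)
          refine le_antisymm (csInf_le' ⟨hmE, hξδ.trans_le hδm, hgt.le.trans hδm⟩)
            (hmin ⟨hξ'.1, ?_⟩)
          by_contra! hlt'
          exact (hcE _ hξ'.1 hlt').not_gt (hcξ.trans_lt hξ'.2.1)
        obtain ⟨γ, hγ, H⟩ := (hg m ⟨hEβ hmE, hgt.le.trans hδm⟩).agree δ hδ hδm
        refine ⟨max c γ, max_lt hc hγ, fun ξ hξ hle => ?_⟩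
        dsimp only
        rw [hnm ξ ((le_max_left _ _).trans hle) (data.subset δ hδ hξ)]
        exact H ξ hξ ((le_max_right _ _).trans hle)

theorem isDense_unifDomainSet (hyp : StandingHypothesis κ S C)
    (data : IsUniformizationData κ S θ A h) (hS : NonReflecting κ S)
    (hbdd : ∀ δ ∈ S, ∀ δ' ∈ S, δ' < δ → ∃ γ < δ', ∀ ξ ∈ A δ, ξ < δ' → ξ < γ)
    {α : Ordinal.{u}} (hα : α < κ.ord) :
    (unifForcing κ S θ A h).IsDense (unifDomainSet κ S θ A h α) := by
  refine ⟨fun g hg => (mem_unifDomainSet.1 hg).1, fun p hp => ?_⟩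
  have hgood := isGood_of_mem data.subset hp
  have hκ : IsSuccLimit κ.ord := isSuccLimit_ord hyp.inaccessible.aleph0_lt.le
  obtain ⟨f, hf, hfp⟩ := exists_extension (fun δ hδ => hyp.isSuccLimit data hδ) data hS hbdd
    hgood (max (domOf p) (succ α)) (max_lt hgood.lt (hκ.succ_lt hα)) (le_max_left _ _)
  refine ⟨graph f (max (domOf p) (succ α)), mem_unifDomainSet.2
    ⟨hf.graph_mem data.subset, ?_⟩, ?_⟩
  · rw [domOf_graph]
    exact (lt_succ α).trans_le (le_max_right _ _)
  · rw [le_unifForcing, ← graph_eq_of_mem hp, graph_subset_iff, graph_eq_of_mem hp]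
    exact ⟨le_max_left _ _, fun ξ hξ => (hfp ξ hξ).symm⟩

end Density

/-! ### Counting conditions, clubs of closure points, and distributivity -/

/-- The index type is one universe up so that subtypes of ordinals and of sets can be used directly;
the cardinality bound makes it small. -/
theorem exists_bound_of_lt_cof {ι : Type (u + 1)} {d : Ordinal.{u}}
    (hι : #ι < Cardinal.lift.{u + 1} d.cof) (G : ι → Ordinal.{u}) (hG : ∀ i, G i < d) :
    ∃ γ < d, ∀ i, G i < γ := by
  have : Small.{u} ι := by
    obtain ⟨c, hc⟩ := Cardinal.mem_range_lift_of_le hι.le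
    obtain ⟨e⟩ : Nonempty (ι ≃ ULift.{u + 1, u} c.out) :=
      Cardinal.eq.1 (by rw [Cardinal.mk_uLift, Cardinal.mk_out, hc])
    exact ⟨c.out, ⟨e.trans Equiv.ulift⟩⟩
  refine ⟨⨆ i, G i + 1, Ordinal.lift_iSup_add_one_lt_of_lt_cof ?_ hG, fun i =>
    Ordinal.lt_iSup_add_one _ i⟩
  rwa [Cardinal.lift_id'.{u, u + 1} #ι, ← Ordinal.lift_cof]

theorem exists_bound_of_isRegular {κ : Cardinal.{u}} (hκ : κ.IsRegular) {ι : Type (u + 1)}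
    (hι : #ι < Cardinal.lift.{u + 1} κ) (G : ι → Ordinal.{u}) (hG : ∀ i, G i < κ.ord) :
    ∃ γ < κ.ord, ∀ i, G i < γ :=
  exists_bound_of_lt_cof (by rwa [hκ.cof_ord]) G hG

theorem mk_Iio_lt_lift {κ : Cardinal.{u}} {b : Ordinal.{u}} (hb : b < κ.ord) :
    #(Set.Iio b) < Cardinal.lift.{u + 1} κ := by
  rw [Cardinal.mk_Iio_ordinal, Cardinal.lift_lt]
  exact Cardinal.lt_ord.1 hb

/-- The points closed under a function from `κ` to `κ` form a club. -/
theorem isClubIn_closed_points {κ : Cardinal.{u}} (hκ : κ.IsRegular) (hκ' : ℵ₀ < κ)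
    (G : Ordinal.{u} → Ordinal.{u}) (hG : ∀ β < κ.ord, G β < κ.ord) {a₀ : Ordinal.{u}}
    (ha₀ : a₀ < κ.ord) :
    IsClubIn {α | α < κ.ord ∧ a₀ < α ∧ ∀ β < α, G β < α} κ.ord := by
  have hlim : IsSuccLimit κ.ord := isSuccLimit_ord hκ'.le
  refine ⟨fun α hα => hα.1, ?_, ?_⟩
  · intro t ht hne _ a ha
    refine ⟨a.2, ?_, fun β hβ => ?_⟩
    · obtain ⟨x, hx⟩ := hne
      exact (ht hx).2.1.trans_le (Subtype.coe_le_coe.2 (ha.1 hx))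
    · obtain ⟨x, hx, hlt⟩ := (lt_isLUB_iff ha (b := ⟨β, hβ.trans a.2⟩)).1 hβ
      exact ((ht hx).2.2 β hlt).trans_le (Subtype.coe_le_coe.2 (ha.1 hx))
  · have hbd : ∀ b, ∃ γ, (b < κ.ord → γ < κ.ord) ∧ b ≤ γ ∧
        (b < κ.ord → ∀ β < b, G β < γ) := by
      intro b
      by_cases hb : b < κ.ord
      · obtain ⟨γ, hγ, H⟩ := exists_bound_of_isRegular hκ (mk_Iio_lt_lift hb)
          (fun i => G i) (fun i => hG i (i.2.trans hb))
        exact ⟨max b γ, fun _ => max_lt hb hγ, le_max_left _ _, fun _ β hβ =>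
          (H ⟨β, hβ⟩).trans_le (le_max_right _ _)⟩
      · exact ⟨b, fun h => h, le_rfl, fun h => absurd h hb⟩
    choose f hfκ hf hfG using hbd
    rintro ⟨a, ha⟩
    have hstart : succ (max a a₀) < κ.ord := hlim.succ_lt (max_lt ha ha₀)
    have hN : nfp f (succ (max a a₀)) < κ.ord :=
      nfp_lt_ord_of_isRegular hκ hκ'.ne' (fun i hi => hfκ i hi) hstart
    refine ⟨⟨_, hN⟩, ⟨hN, ?_, fun β hβ => ?_⟩, ?_⟩
    · exact (lt_succ_of_le (le_max_right _ _)).trans_le (le_nfp _ _)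
    -- A point below the limit of the iterates is below some iterate, and the next iterate dominates
    -- `G` there.
    · obtain ⟨n, hn⟩ := lt_nfp_iff.1 hβ
      have hn' : f^[n] (succ (max a a₀)) < κ.ord := (iterate_le_nfp _ _ _).trans_lt hN
      refine (hfG _ hn' β hn).trans_le ?_
      rw [← Function.iterate_succ_apply' f n]
      exact iterate_le_nfp _ _ _
    · exact Subtype.coe_le_coe.1 (((le_max_left a a₀).trans (le_succ _)).trans (le_nfp f _))

theorem _root_.ZFSet.card_prod_le (x y : ZFSet.{u}) : (ZFSet.prod x y).card ≤ x.card * y.card := by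
  rw [← Cardinal.lift_le.{u + 1}, Cardinal.lift_mul, ← ZFSet.cardinalMk_coe_sort,
    ← ZFSet.cardinalMk_coe_sort, ← ZFSet.cardinalMk_coe_sort, Cardinal.mul_def]
  refine Cardinal.mk_le_of_surjective (f := fun z : x × y =>
    (⟨ZFSet.pair z.1 z.2, ZFSet.pair_mem_prod.2 ⟨z.1.2, z.2.2⟩⟩ : ZFSet.prod x y)) ?_
  rintro ⟨z, hz⟩
  obtain ⟨a, ha, b, hb, rfl⟩ := ZFSet.mem_prod.1 hz
  exact ⟨(⟨a, ha⟩, ⟨b, hb⟩), rfl⟩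

theorem _root_.ZFSet.exists_enumeration (X : ZFSet.{u}) :
    ∃ s : Ordinal.{u} → ZFSet.{u}, ∀ g ∈ X, ∃ ι < X.card.ord, s ι = g := by
  classical
  have hc : #(Set.Iio X.card.ord) = #X := by
    rw [Cardinal.mk_Iio_ordinal, Cardinal.card_ord, ZFSet.cardinalMk_coe_sort]
  obtain ⟨e⟩ := Cardinal.eq.1 hc
  refine ⟨fun ι => if hι : ι < X.card.ord then (e ⟨ι, hι⟩).1 else ∅, fun g hg => ?_⟩
  obtain ⟨⟨ι, hι⟩, he⟩ := e.surjective ⟨g, hg⟩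
  exact ⟨ι, hι, by
    dsimp only
    rw [dif_pos (show ι < X.card.ord from hι), he]⟩

/-- A form of definition by transfinite recursion with choices. -/
theorem exists_recursive_choice {I X : Type*} [Preorder I] [WellFoundedLT I] [Nonempty X]
    (P : I → (I → X) → X → Prop)
    (hP : ∀ i f f' x, (∀ j < i, f j = f' j) → P i f x → P i f' x) :
    ∃ q : I → X, ∀ i, (∃ x, P i q x) → P i q (q i) := by
  classical
  -- The history is padded by an arbitrary value at indices not below `i`; by `hP` the padding is
  -- irrelevant.
  let step : ∀ i, (∀ j, j < i → X) → X := fun i hist =>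
    Classical.epsilon (P i fun j => if hj : j < i then hist j hj else Classical.arbitrary X)
  let q : I → X := (wellFounded_lt (α := I)).fix step
  refine ⟨q, fun i ⟨x, hx⟩ => ?_⟩
  have hq : q i = Classical.epsilon (P i fun j => if j < i then q j else Classical.arbitrary X) := by
    have := (wellFounded_lt (α := I)).fix_eq step i
    simpa only [step, dite_eq_ite] using! this
  have hagree : ∀ j < i, q j = if j < i then q j else Classical.arbitrary X :=
    fun j hj => (if_pos hj).symm
  rw [hq]
  exact hP i _ _ _ (fun j hj => (hagree j hj).symm)
    (Classical.epsilon_spec ⟨x, hP i _ _ x hagree hx⟩)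

section Distributive

variable {κ θ : Cardinal.{u}} {S : Set Ordinal.{u}} {A : Ordinal.{u} → Set Ordinal.{u}}
  {C : Ordinal.{u} → Set Ordinal.{u}} {h : Ordinal.{u} → Ordinal.{u} → Ordinal.{u}}

/-- The set of conditions whose domain is at most `β`. -/
noncomputable def condsBelow (κ : Cardinal.{u}) (S : Set Ordinal.{u}) (θ : Cardinal.{u})
    (A : Ordinal.{u} → Set Ordinal.{u}) (h : Ordinal.{u} → Ordinal.{u} → Ordinal.{u})
    (β : Ordinal.{u}) : ZFSet.{u} :=
  ZFSet.sep (fun g => domOf g ≤ β) (unifForcing κ S θ A h).carrier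

theorem mem_condsBelow {β : Ordinal.{u}} {g : ZFSet.{u}} :
    g ∈ condsBelow κ S θ A h β ↔ g ∈ (unifForcing κ S θ A h).carrier ∧ domOf g ≤ β :=
  ZFSet.mem_sep

/-- These conditions are subsets of `β × θ`, and `κ` is a strong limit. -/
theorem card_condsBelow_lt (hκ : κ.IsInaccessible) (hθ : θ < κ)
    (hA : ∀ δ ∈ S, A δ ⊆ Set.Iio δ) {β : Ordinal.{u}} (hβ : β < κ.ord) :
    (condsBelow κ S θ A h β).card < κ := by
  have hsub : condsBelow κ S θ A h β ⊆
      ZFSet.powerset (ZFSet.prod β.toZFSet θ.ord.toZFSet) := by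
    intro g hg
    obtain ⟨hgQ, hgβ⟩ := mem_condsBelow.1 hg
    rw [ZFSet.mem_powerset]
    intro z hz
    rw [← graph_eq_of_mem hgQ] at hz
    obtain ⟨ξ, hξ, rfl⟩ := mem_seqCode.1 hz
    exact ZFSet.pair_mem_prod.2 ⟨Ordinal.toZFSet_mem_toZFSet_iff.2 (hξ.trans_le hgβ),
      Ordinal.toZFSet_mem_toZFSet_iff.2 ((isGood_of_mem hA hgQ).val ξ hξ)⟩
  refine (ZFSet.card_mono hsub).trans_lt ?_
  rw [ZFSet.card_powerset]
  refine hκ.isStrongPrelimit ?_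
  refine (ZFSet.card_prod_le _ _).trans_lt (Cardinal.mul_lt_of_lt hκ.aleph0_lt.le ?_ ?_)
  · rw [Ordinal.card_toZFSet]
    exact Cardinal.lt_ord.1 hβ
  · rwa [Ordinal.card_toZFSet, Cardinal.card_ord]

theorem ForcingNotion.OrdName.ForcesEq.mono {τ : (unifForcing κ S θ A h).OrdName}
    {p q : ZFSet.{u}} {γ : Ordinal.{u}} (hp : τ.ForcesEq p γ) (hpq : p ⊆ q) : τ.ForcesEq q γ := by
  rintro a ha ⟨r, hr, hqr, har⟩
  exact hp a ha ⟨r, hr, fun _ hz => hqr (hpq hz), har⟩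

/-- First lengthen the domain, then pass to a common extension with a member of the maximal
antichain: it is incompatible with all other members, so the value is decided. -/
theorem exists_deciding (hdense : ∀ α < κ.ord,
      (unifForcing κ S θ A h).IsDense (unifDomainSet κ S θ A h α))
    (τ : (unifForcing κ S θ A h).OrdName) {p : ZFSet.{u}}
    (hp : p ∈ (unifForcing κ S θ A h).carrier) {b : Ordinal.{u}} (hb : b < κ.ord) :
    ∃ q ∈ (unifForcing κ S θ A h).carrier, p ⊆ q ∧ b < domOf q ∧ ∃ γ, τ.ForcesEq q γ := by
  obtain ⟨g, hg, hpg⟩ := (hdense b hb).2 p hp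
  obtain ⟨hgQ, hbg⟩ := mem_unifDomainSet.1 hg
  obtain ⟨a, ha, r, hr, hgr, har⟩ := τ.maximal g hgQ
  refine ⟨r, hr, fun z hz => hgr (hpg hz), hbg.trans_le ((subset_iff_of_mem hgQ hr).1 hgr).1,
    τ.val a, ?_⟩
  rintro a' ha' ⟨r', hr', hrr', har'⟩
  by_contra hne
  exact τ.incompatible a' ha' a ha (fun h => hne (congrArg τ.val h))
    ⟨r', hr', har', fun z hz => hrr' (har hz)⟩

/-- The chain `q` alternates between deciding the next name past `e i` and taking unions. The points
`e i` are closed under the bound `G`, so the `i`-th condition keeps its domain within `e i`, and at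
limits the domain is exactly `e i ∉ S`. -/
theorem addsNoNewSequences (hyp : StandingHypothesis κ S C)
    (data : IsUniformizationData κ S θ A h) (hdense : ∀ α < κ.ord,
      (unifForcing κ S θ A h).IsDense (unifDomainSet κ S θ A h α)) :
    (unifForcing κ S θ A h).AddsNoNewSequences κ := by
  intro ζ hζ τ p hp
  have hreg := hyp.inaccessible.isRegular
  have hlim : IsSuccLimit κ.ord := isSuccLimit_ord hyp.inaccessible.aleph0_lt.le
  choose! F hFQ hgF hbF hFτ using
    fun g i b (H : g ∈ (unifForcing κ S θ A h).carrier ∧ b < κ.ord) =>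
      exists_deciding hdense (τ i) H.1 H.2
  have hFκ : ∀ g i b, g ∈ (unifForcing κ S θ A h).carrier → b < κ.ord →
      domOf (F g i b) < κ.ord := fun g i b hg hb =>
    (isGood_of_mem data.subset (hFQ g i b ⟨hg, hb⟩)).lt
  have hbd : ∀ b, ∃ γ, b < κ.ord → γ < κ.ord ∧
      ∀ g ∈ condsBelow κ S θ A h b, ∀ i < ζ, domOf (F g i b) < γ := by
    intro b
    by_cases hb : b < κ.ord
    · have h1 : ∀ g ∈ condsBelow κ S θ A h b, ∃ γ < κ.ord, ∀ i < ζ, domOf (F g i b) < γ := by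
        intro g hg
        obtain ⟨γ, hγ, H⟩ := exists_bound_of_isRegular hreg (mk_Iio_lt_lift hζ)
          (fun i => domOf (F g i b)) (fun i => hFκ g i b (mem_condsBelow.1 hg).1 hb)
        exact ⟨γ, hγ, fun i hi => H ⟨i, hi⟩⟩
      choose! γ₁ hγ₁ H₁ using h1
      have hcard : #(condsBelow κ S θ A h b) < Cardinal.lift.{u + 1} κ := by
        rw [ZFSet.cardinalMk_coe_sort, Cardinal.lift_lt]
        exact card_condsBelow_lt hyp.inaccessible data.lt data.subset hb
      obtain ⟨γ, hγ, H⟩ := exists_bound_of_isRegular hreg hcard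
        (fun g => γ₁ g) (fun g => hγ₁ g g.2)
      exact ⟨γ, fun _ => ⟨hγ, fun g hg i hi => (H₁ g hg i hi).trans (H ⟨g, hg⟩)⟩⟩
    · exact ⟨0, fun h => absurd h hb⟩
  choose G hG using hbd
  have hclub := isClubIn_closed_points hreg hyp.inaccessible.aleph0_lt G
    (fun β hβ => (hG β hβ).1) (isGood_of_mem data.subset hp).lt
  -- Length `succ ζ` provides the extra point `e ζ`, at which the final condition bounds all `ζ`
  -- decisions.
  obtain ⟨e, ⟨hemono, hecont⟩, he⟩ := hyp.fat_compl _ hclub (succ ζ) (hlim.succ_lt hζ)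
  have heκ : ∀ i ≤ ζ, e i < κ.ord := fun i hi => (he i (lt_succ_of_le hi)).1.1
  have hmono : ∀ i j, i < j → j ≤ ζ → e i < e j := fun i j hij hj =>
    hemono (lt_succ_of_le (hij.le.trans hj)) (lt_succ_of_le hj) hij
  let P : Ordinal.{u} → (Ordinal.{u} → ZFSet.{u}) → ZFSet.{u} → Prop := fun i q x =>
    x ∈ (unifForcing κ S θ A h).carrier ∧ p ⊆ x ∧ domOf x ≤ e i ∧
      ∀ j < i, F (q j) j (e j) ⊆ x
  obtain ⟨q, hq⟩ := exists_recursive_choice P (by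
    rintro i f f' x hff' ⟨h1, h2, h3, h4⟩
    exact ⟨h1, h2, h3, fun j hj => hff' j hj ▸ h4 j hj⟩)
  have key : ∀ i ≤ ζ, P i q (q i) := by
    intro i
    induction i using WellFoundedLT.induction with
    | _ i ih =>
    intro hi
    have ih' : ∀ j < i, P j q (q j) := fun j hj => ih j hj (hj.le.trans hi)
    have hFQ' : ∀ j < i, F (q j) j (e j) ∈ (unifForcing κ S θ A h).carrier := fun j hj =>
      hFQ _ _ _ ⟨(ih' j hj).1, heκ j (hj.le.trans hi)⟩
    have hqF : ∀ j < i, q j ⊆ F (q j) j (e j) := fun j hj =>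
      hgF _ _ _ ⟨(ih' j hj).1, heκ j (hj.le.trans hi)⟩
    have hFe : ∀ j < i, domOf (F (q j) j (e j)) < e i := fun j hj => by
      have hjκ := heκ j (hj.le.trans hi)
      refine ((hG (e j) hjκ).2 _ (mem_condsBelow.2 ⟨(ih' j hj).1, (ih' j hj).2.2.1⟩) j
        (hj.trans_le hi)).trans ?_
      exact (he i (lt_succ_of_le hi)).1.2.2 _ (hmono j i hj hi)
    have hFF : ∀ j k, j < k → k < i → F (q j) j (e j) ⊆ F (q k) k (e k) := fun j k hjk hk z hz =>
      hqF k hk ((ih' k hk).2.2.2 j hjk hz)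
    refine hq i ?_
    rcases Ordinal.zero_or_succ_or_isSuccLimit i with rfl | ⟨k, rfl⟩ | hilim
    · exact ⟨p, hp, fun _ hz => hz, (he 0 (lt_succ_of_le hi)).1.2.1.le,
        fun j hj => absurd hj not_lt_zero⟩
    · have hk : k < succ k := lt_succ k
      refine ⟨_, hFQ' k hk, fun z hz => hqF k hk ((ih' k hk).2.1 hz), (hFe k hk).le,
        fun j hj => ?_⟩
      rcases (Order.lt_succ_iff.1 hj).lt_or_eq with hlt | rfl
      · exact hFF j k hlt hk
      · exact fun _ hz => hz
    -- The domains lie above `e j` and below `e i`, so by continuity they converge to `e i`.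
    · obtain ⟨x, hx, hxe, hsub⟩ := exists_union_mem data.subset
        (fun j : Set.Iio i => F (q j) j (e j)) (fun j => hFQ' j j.2)
        (fun j k => by
          rcases lt_trichotomy j.1 k.1 with hlt | heq | hgt
          · exact Or.inl (hFF _ _ hlt k.2)
          · rw [Subtype.ext heq]
            exact Or.inl fun _ hz => hz
          · exact Or.inr (hFF _ _ hgt j.2))
        (heκ i hi) (fun j => (hFe j j.2).le)
        (fun ξ hξ => by
          obtain ⟨_, ⟨j, hj, rfl⟩, hlt⟩ :=
            (lt_isLUB_iff (hecont i (lt_succ_of_le hi) hilim)).1 hξ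
          exact ⟨⟨j, hj⟩, hlt.trans
            (hbF _ _ _ ⟨(ih' j hj).1, heκ j (le_trans (le_of_lt hj) hi)⟩)⟩)
        (fun hS => absurd hS (he i (lt_succ_of_le hi)).2)
      refine ⟨x, hx, fun z hz => ?_, hxe.le, fun j hj => hsub ⟨j, hj⟩⟩
      have h0 : 0 < i := hilim.bot_lt
      exact hsub ⟨0, h0⟩ (hqF 0 h0 ((ih' 0 h0).2.1 hz))
  obtain ⟨h1, h2, -, h4⟩ := key ζ le_rfl
  have hdec : ∀ i < ζ, ∃ γ, (τ i).ForcesEq (F (q i) i (e i)) γ := fun i hi =>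
    hFτ _ _ _ ⟨(key i hi.le).1, heκ i hi.le⟩
  choose! γ hγ using hdec
  exact ⟨q ζ, h1, h2, γ, fun i hi => (hγ i hi).mono (h4 i hi)⟩

end Distributive

/-! ### The parameter of the submodels, and completeness for the first family -/

theorem IsElemSub.seqCode_apply_mem {χ : Cardinal.{u}} {W : H χ → H χ → Prop} {N : ZFSet.{u}}
    (hχ : ℵ₀ ≤ χ) (hN : IsElemSub χ W N) {f : Ordinal.{u} → ZFSet.{u}} {o j : Ordinal.{u}}
    (hf : seqCode f o ∈ N) (hj : j.toZFSet ∈ N) (hjo : j < o) : f j ∈ N :=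
  hN.apply_mem hχ hf hj (pair_mem_seqCode.2 ⟨hjo, rfl⟩) fun _ hc => (pair_mem_seqCode.1 hc).2

section Parameter

variable {κ θ : Cardinal.{u}} {S : Set Ordinal.{u}} {A : Ordinal.{u} → Set Ordinal.{u}}
  {C : Ordinal.{u} → Set Ordinal.{u}} {h : Ordinal.{u} → Ordinal.{u} → Ordinal.{u}}

/-- An enumeration of the set `X` by the ordinals below its cardinality. -/
noncomputable def enumOf (X : ZFSet.{u}) : Ordinal.{u} → ZFSet.{u} := (ZFSet.exists_enumeration X).choose

theorem exists_enumOf_eq {X g : ZFSet.{u}} (hg : g ∈ X) : ∃ ι < X.card.ord, enumOf X ι = g :=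
  (ZFSet.exists_enumeration X).choose_spec g hg

/-- A set coding the forcing notion in a way convenient for elementary submodels. -/
noncomputable def param (κ : Cardinal.{u}) (S : Set Ordinal.{u}) (θ : Cardinal.{u})
    (A : Ordinal.{u} → Set Ordinal.{u}) (h : Ordinal.{u} → Ordinal.{u} → Ordinal.{u}) : ZFSet.{u} :=
  ZFSet.pair (seqCode (unifDomainSet κ S θ A h) κ.ord) <|
  ZFSet.pair (ZFSet.range fun g : (unifForcing κ S θ A h).carrier =>
    ZFSet.pair g.1 (domOf g.1).toZFSet) <|
  ZFSet.pair (seqCode (fun β => (condsBelow κ S θ A h β).card.ord.toZFSet) κ.ord) <|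
  ZFSet.pair (seqCode (fun β => seqCode (enumOf (condsBelow κ S θ A h β))
    (condsBelow κ S θ A h β).card.ord) κ.ord) θ.ord.toZFSet

variable {χ : Cardinal.{u}} {W : H χ → H χ → Prop} {N : ZFSet.{u}}

theorem IsElemSub.unifDomainSet_mem (hχ : ℵ₀ ≤ χ) (hN : IsElemSub χ W N)
    (hx : param κ S θ A h ∈ N) {β : Ordinal.{u}} (hβ : β < κ.ord) (hβN : β.toZFSet ∈ N) :
    unifDomainSet κ S θ A h β ∈ N :=
  hN.seqCode_apply_mem hχ (hN.fst_mem hχ hx) hβN hβ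

theorem IsElemSub.domOf_mem (hχ : ℵ₀ ≤ χ) (hN : IsElemSub χ W N)
    (hx : param κ S θ A h ∈ N) {g : ZFSet.{u}} (hg : g ∈ (unifForcing κ S θ A h).carrier)
    (hgN : g ∈ N) : (domOf g).toZFSet ∈ N := by
  refine hN.apply_mem hχ (hN.fst_mem hχ (hN.snd_mem hχ hx)) hgN
    (ZFSet.mem_range.2 ⟨⟨g, hg⟩, rfl⟩) fun c hc => ?_
  obtain ⟨⟨g', hg'⟩, e⟩ := ZFSet.mem_range.1 hc
  obtain ⟨rfl, rfl⟩ := ZFSet.pair_inj.1 e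
  rfl

theorem IsElemSub.theta_mem (hχ : ℵ₀ ≤ χ) (hN : IsElemSub χ W N)
    (hx : param κ S θ A h ∈ N) : θ.ord.toZFSet ∈ N :=
  hN.snd_mem hχ (hN.snd_mem hχ (hN.snd_mem hχ (hN.snd_mem hχ hx)))

/-- If `N ∩ κ` is the ordinal `α`, then all conditions with domain below `α` are in `N`. -/
theorem IsElemSub.cond_mem (hχ : ℵ₀ ≤ χ) (hN : IsElemSub χ W N) (hκ : κ.IsInaccessible)
    (data : IsUniformizationData κ S θ A h)
    (hx : param κ S θ A h ∈ N) {α : Ordinal.{u}}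
    (hα : ∀ β < κ.ord, β.toZFSet ∈ N ↔ β < α) {g : ZFSet.{u}}
    (hg : g ∈ (unifForcing κ S θ A h).carrier) (hgα : domOf g < α) : g ∈ N := by
  have hdκ : domOf g < κ.ord := (isGood_of_mem data.subset hg).lt
  have hdN := (hα _ hdκ).2 hgα
  have hx3 := hN.snd_mem hχ (hN.snd_mem hχ hx)
  have hcN := hN.seqCode_apply_mem hχ (hN.fst_mem hχ hx3) hdN hdκ
  have hsN := hN.seqCode_apply_mem hχ (hN.fst_mem hχ (hN.snd_mem hχ hx3)) hdN hdκ
  have hcκ : (condsBelow κ S θ A h (domOf g)).card.ord < κ.ord :=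
    Cardinal.ord_lt_ord.2 (card_condsBelow_lt hκ data.lt data.subset hdκ)
  -- The number of conditions with this domain bound is a cardinal below `κ` lying in `N`. As `N ∩
  -- κ` is an ordinal, all indices below it are in `N`, and so are the conditions they enumerate.
  obtain ⟨ι, hι, e⟩ := exists_enumOf_eq (mem_condsBelow.2 ⟨hg, le_rfl⟩)
  rw [← e]
  exact hN.seqCode_apply_mem hχ hsN
    ((hα ι (hι.trans hcκ)).2 (hι.trans ((hα _ hcκ).1 hcN))) hι

/-- A complementary pair of limit length for the family of sequences off `S` has a trace off `S` at
its last point, and smaller traces before. -/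
theorem IsComplementaryPair.exists_trace {N : Ordinal.{u} → ZFSet.{u}} {a : SetSeq.{u}}
    (hp : IsComplementaryPair κ κ χ W (family₀ κ S) N a) (hlim : IsSuccLimit a.last) :
    ∃ α < κ.ord, α ∉ S ∧ (∀ β < κ.ord, β.toZFSet ∈ N a.last ↔ β < α) ∧
      ∀ ε < a.last, ∃ b < α, ∀ β < κ.ord, β.toZFSet ∈ N ε → β < b := by
  obtain ⟨-, f, ⟨hmono, hcont⟩, hf⟩ := hp.mem
  obtain ⟨n, hn⟩ := hp.obeys
  -- At limit length the error `n` is absorbed, so the trace of the last model is exactly `f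
  -- a.last`.
  have hadd : ∀ i < a.last, i + n < a.last := fun i hi => hlim.add_natCast_lt hi n
  have hlt : ∀ i < a.last, f i < f a.last := fun i hi => hmono (Set.mem_Iic.2 hi.le) (Set.mem_Iic.2 le_rfl) hi
  have hsub : ∀ i < a.last, ∀ β < f i, β.toZFSet ∈ N i := by
    intro i hi β hβ
    have := (hn i hi).1
    rw [(hf i hi.le).2.2] at this
    exact (ZFSet.mem_inter.1 (this (Ordinal.toZFSet_mem_toZFSet_iff.2 hβ))).1
  have hsup : ∀ i < a.last, ∀ β < κ.ord, β.toZFSet ∈ N i → β < f (i + n) := by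
    intro i hi β hβ hβN
    have := (hn i hi).2 (hadd i hi).le
    rw [(hf _ (hadd i hi).le).2.2] at this
    exact Ordinal.toZFSet_mem_toZFSet_iff.1
      (this (ZFSet.mem_inter.2 ⟨hβN, Ordinal.toZFSet_mem_toZFSet_iff.2 hβ⟩))
  refine ⟨f a.last, (hf _ le_rfl).1, (hf _ le_rfl).2.1, fun β hβ => ⟨fun hβN => ?_, fun hβf => ?_⟩,
    fun ε hε => ⟨f (ε + n), hlt _ (hadd ε hε), hsup ε hε⟩⟩
  · obtain ⟨j, hj, hβj⟩ := (hp.chain.cont _ le_rfl hlim _).1 hβN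
    exact (hsup j hj β hβ hβj).trans (hlt _ (hadd j hj))
  · obtain ⟨_, ⟨j, hj, rfl⟩, hβj⟩ := (lt_isLUB_iff (hcont a.last (Set.mem_Iic.2 le_rfl) hlim)).1 hβf
    exact hp.chain.mono j _ (le_of_lt hj) le_rfl (hsub j hj β hβj)

/-- The domains of the members of a generic sequence converge to the trace of the last model. -/
theorem domOf_generic (hχ : ℵ₀ ≤ χ)
    (hdense : ∀ α < κ.ord, (unifForcing κ S θ A h).IsDense (unifDomainSet κ S θ A h α))
    {N : Ordinal.{u} → ZFSet.{u}} {d : Ordinal.{u}} (hd : IsSuccLimit d)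
    (hN : ∀ ε ≤ d, IsElemSub χ W (N ε)) (hmono : ∀ i j, i ≤ j → j ≤ d → N i ⊆ N j)
    (hunion : ∀ x ∈ N d, ∃ ε < d, x ∈ N ε) (hx : param κ S θ A h ∈ N d) {α : Ordinal.{u}}
    (hακ : α ≤ κ.ord) (hα : ∀ β < κ.ord, β.toZFSet ∈ N d ↔ β < α)
    (hA : ∀ δ ∈ S, A δ ⊆ Set.Iio δ)
    {p : Ordinal.{u} → ZFSet.{u}} {n : ℕ} (hp : (unifForcing κ S θ A h).IsGeneric N d p n) :
    (∀ ε < d, domOf (p ε) < α) ∧ ∀ ξ < α, ∃ ε < d, ξ < domOf (p ε) := by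
  refine ⟨fun ε hε => ?_, fun ξ hξ => ?_⟩
  · have hpQ := hp.increasing.1 ε hε
    exact (hα _ (isGood_of_mem hA hpQ).lt).1 ((hN d le_rfl).domOf_mem hχ hx hpQ (hp.mem ε hε))
  · have hξκ := hξ.trans_le hακ
    -- The parameter and `ξ` both appear at some stage before `d`; the dense set for `ξ` then lies
    -- in that model and is met `n` steps later.
    obtain ⟨ε₁, hε₁, h₁⟩ := hunion _ hx
    obtain ⟨ε₂, hε₂, h₂⟩ := hunion _ ((hα ξ hξκ).2 hξ)
    have hε : max ε₁ ε₂ < d := max_lt hε₁ hε₂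
    have hI := (hN _ hε.le).unifDomainSet_mem hχ
      (hmono _ _ (le_max_left ε₁ ε₂) hε.le h₁) hξκ (hmono _ _ (le_max_right ε₁ ε₂) hε.le h₂)
    refine ⟨max ε₁ ε₂ + n, hd.add_natCast_lt hε n, ?_⟩
    refine (mem_unifDomainSet.1 (hp.meets _ (hd.add_natCast_lt hε n) _ hI ⟨hdense ξ hξκ, ?_⟩)).2
    intro r hr q hq hrq
    obtain ⟨hrQ, hξr⟩ := mem_unifDomainSet.1 hr
    exact mem_unifDomainSet.2 ⟨hq, hξr.trans_le ((subset_iff_of_mem hrQ hq).1 hrq).1⟩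

/-- At limit length the domains converge to a trace off `S`, so no requirement arises at the
supremum; at successor length the last condition is already a bound. -/
theorem completeFor_family₀ (hyp : StandingHypothesis κ S C)
    (data : IsUniformizationData κ S θ A h)
    (hdense : ∀ α < κ.ord, (unifForcing κ S θ A h).IsDense (unifDomainSet κ S θ A h α)) :
    (unifForcing κ S θ A h).CompleteFor κ κ (family₀ κ S) := by
  obtain ⟨χ₀, hχ₀⟩ := exists_forall_inH (param κ S θ A h)
  refine ⟨χ₀, fun χ hχ hreg W _ => ⟨param κ S θ A h, hχ₀ χ hχ, ?_⟩⟩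
  rintro N a p hpair - hx ⟨n, hgen⟩
  rcases Ordinal.zero_or_succ_or_isSuccLimit a.last with h0 | ⟨k, hk⟩ | hlim
  · refine ⟨∅, empty_mem_unifForcing ?_ hyp.zero_notMem, fun i hi => ?_⟩
    · exact hyp.inaccessible.isRegular.ord_pos
    · rw [h0] at hi
      exact absurd hi not_lt_zero
  · have hkl : k < a.last := hk ▸ lt_succ k
    exact ⟨p k, hgen.increasing.1 k hkl, fun i hi =>
      hgen.increasing.2 i k (Order.lt_succ_iff.1 (hk ▸ hi)) hkl⟩
  · obtain ⟨α, hακ, hαS, hα, -⟩ := hpair.exists_trace hlim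
    obtain ⟨hle, hcof⟩ := domOf_generic hreg.aleph0_le hdense hlim hpair.chain.elem
      hpair.chain.mono (fun x hx => (hpair.chain.cont _ le_rfl hlim x).1 hx)
      (hpair.chain.mono 0 _ zero_le le_rfl hx) hακ.le hα data.subset hgen
    obtain ⟨q, hq, -, hsub⟩ := exists_union_mem data.subset (fun i : Set.Iio a.last => p i)
      (fun i => hgen.increasing.1 i i.2)
      (fun i j => (le_total i.1 j.1).imp (fun hij => hgen.increasing.2 i j hij j.2)
        (fun hij => hgen.increasing.2 j i hij i.2))
      hακ (fun i => (hle i i.2).le)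
      (fun ξ hξ => by
        obtain ⟨ε, hε, hlt⟩ := hcof ξ hξ
        exact ⟨⟨ε, hε⟩, hlt⟩)
      (fun hS => absurd hS hαS)
    exact ⟨q, hq, fun i hi => hsub ⟨i, hi⟩⟩

end Parameter

/-! ### The game -/

theorem nxt_le_iff {j : WithBot Ordinal.{u}} {i : Ordinal.{u}} :
    nxt j ≤ i ↔ j < (i : WithBot Ordinal.{u}) := by
  cases j with
  | bot => simp [nxt]
  | coe j => simp [nxt, WithBot.coe_lt_coe]

/-! ### Traces of ruled sequences and the cardinal arithmetic that bounds the ladders. -/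

section Ruled

variable {κ θ : Cardinal.{u}} {S : Set Ordinal.{u}} {A : Ordinal.{u} → Set Ordinal.{u}}
  {C : Ordinal.{u} → Set Ordinal.{u}} {h : Ordinal.{u} → Ordinal.{u} → Ordinal.{u}}
  {χ : Cardinal.{u}} {W : H χ → H χ → Prop} {M : Ordinal.{u} → ZFSet.{u}} {δ : Ordinal.{u}}
  {N : WithBot Ordinal.{u} → Ordinal.{u} → ZFSet.{u}} {d : WithBot Ordinal.{u} → Ordinal.{u}}

theorem IsEnumeration.lift_card {D : Set Ordinal.{u}} {ρ : Ordinal.{u}}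
    {e : Ordinal.{u} → Ordinal.{u}} (he : IsEnumeration D ρ e) :
    Cardinal.lift.{u + 1} ρ.card = #D := by
  rw [← he.2, Cardinal.mk_image_eq_of_injOn _ _ he.1.injOn, Cardinal.mk_Iio_ordinal]

/-- The ordinals `tr i` are the traces on `κ` of the models `M i`. -/
structure IsTrace (κ : Cardinal.{u}) (S : Set Ordinal.{u}) (M : Ordinal.{u} → ZFSet.{u})
    (δ : Ordinal.{u}) (tr : Ordinal.{u} → Ordinal.{u}) : Prop where
  mem_iff : ∀ i ≤ δ, ∀ β < κ.ord, β.toZFSet ∈ M i ↔ β < tr i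
  strictMono : ∀ i j, i < j → j ≤ δ → tr i < tr j
  last_mem : tr δ ∈ S
  lt : ∀ i ≤ δ, tr i < κ.ord
  card_le : δ.card ≤ (M 0).card

theorem IsTrace.mono {tr : Ordinal.{u} → Ordinal.{u}} (ht : IsTrace κ S M δ tr) {i j : Ordinal.{u}}
    (hij : i ≤ j) (hj : j ≤ δ) : tr i ≤ tr j := by
  rcases hij.eq_or_lt with rfl | hlt
  exacts [le_rfl, (ht.strictMono i j hlt hj).le]

theorem IsTrace.card_toZFSet_le {tr : Ordinal.{u} → Ordinal.{u}} (ht : IsTrace κ S M δ tr)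
    {α i : Ordinal.{u}} (hi : i ≤ δ) (hα : α ≤ tr i) : α.card ≤ (M i).card := by
  rw [← Ordinal.card_toZFSet]
  refine ZFSet.card_mono fun z hz => ?_
  obtain ⟨β, hβ, rfl⟩ := Ordinal.mem_toZFSet_iff.1 hz
  have hβ' := hβ.trans_le hα
  exact (ht.mem_iff i hi β (hβ'.trans (ht.lt i hi))).2 hβ'

theorem IsRuledBy.exists_trace (hyp : StandingHypothesis κ S C)
    (hM : IsRuledBy κ κ χ W (family₀ κ S) (family₁ S C) M δ N d) (hδ : 0 < δ) :
    ∃ tr, IsTrace κ S M δ tr := by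
  classical
  obtain ⟨D, hDS, ρ, e, he, η, hηρ, hval, hlast⟩ := hM.trace_mem
  dsimp only at hηρ hval hlast
  have hD : D < κ.ord := hyp.subset hDS
  have hηi : ∀ i < δ, η + i < ρ := fun i hi => by
    rw [← hηρ]
    exact (add_lt_add_iff_left η).2 hi
  have heC : ∀ i < δ, e (η + i) ∈ C D := fun i hi => by
    rw [← he.2]
    exact mem_image_of_mem e (hηi i hi)
  have heD : ∀ i < δ, e (η + i) < D := fun i hi => (hyp.club D hDS).1 (heC i hi)
  let tr : Ordinal.{u} → Ordinal.{u} := fun i => if i < δ then e (η + i) else D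
  have htr : ∀ i < δ, tr i = e (η + i) := fun i hi => if_pos hi
  have htrδ : tr δ = D := if_neg (lt_irrefl δ)
  have htrκ : ∀ i ≤ δ, tr i < κ.ord := by
    intro i hi
    rcases hi.lt_or_eq with hlt | rfl
    · rw [htr i hlt]; exact (heD i hlt).trans hD
    · rwa [htrδ]
  have hmem : ∀ i ≤ δ, M i ∩ κ.ord.toZFSet = (tr i).toZFSet := by
    intro i hi
    rcases hi.lt_or_eq with hlt | rfl
    · rw [htr i hlt]; exact hval i hlt
    · rw [htrδ]; exact hlast
  have hiff : ∀ i ≤ δ, ∀ β < κ.ord, β.toZFSet ∈ M i ↔ β < tr i := fun i hi β hβ => by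
    rw [← Ordinal.toZFSet_mem_toZFSet_iff, ← hmem i hi, ZFSet.mem_inter,
      Ordinal.toZFSet_mem_toZFSet_iff, and_iff_left hβ]
  refine ⟨tr, hiff, fun i j hij hj => ?_, htrδ.symm ▸ hDS, htrκ, ?_⟩
  · have hi := hij.trans_le hj
    rw [htr i hi]
    rcases hj.lt_or_eq with hlt | rfl
    · rw [htr j hlt]
      exact he.1 (hηi i hi) (hηi j hlt) ((add_lt_add_iff_left η).2 hij)
    · rw [htrδ]; exact heD i hi
  -- The hypothesis that the order type of `C D` is below `min (C D)` is used here: the sequence has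
  -- at most `|otp (C D)| ≤ |tr 0| ≤ |M 0|` terms. Two enumerations of `C D` are compared by
  -- cardinality only, which suffices.
  · obtain ⟨ρ', e', he', -, hmin⟩ := hyp.otp_lt D hDS
    have hcard : ρ.card = ρ'.card := by
      rw [← Cardinal.lift_inj.{u, u + 1}, he.lift_card, he'.lift_card]
    have h1 : δ.card ≤ ρ.card := Ordinal.card_le_card (hηρ ▸ (le_add_self : δ ≤ η + δ))
    have h2 : ρ'.card ≤ (tr 0).card := by
      rw [htr 0 hδ]
      exact Ordinal.card_le_card (hmin _ (heC 0 hδ)).le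
    rw [hcard] at h1
    refine (h1.trans h2).trans ?_
    rw [← Ordinal.card_toZFSet, ← hmem 0 zero_le]
    exact ZFSet.card_mono fun z hz => (ZFSet.mem_inter.1 hz).1

theorem IsRuledBy.isSuccLimit {E₀ E₁ : Set SetSeq.{u}} (hM : IsRuledBy κ κ χ W E₀ E₁ M δ N d)
    {i : WithBot Ordinal.{u}} (hi : i < (δ : WithBot Ordinal.{u})) : IsSuccLimit (d i) := by
  rw [← Ordinal.one_lt_cof_iff]
  refine lt_of_le_of_lt ?_ (hM.cof_gt i hi)
  exact Cardinal.one_le_iff_ne_zero.2 (Cardinal.power_ne_zero _ two_ne_zero)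

theorem IsRuledBy.mem_approx {E₀ E₁ : Set SetSeq.{u}} (hM : IsRuledBy κ κ χ W E₀ E₁ M δ N d)
    {i : WithBot Ordinal.{u}} (hi : i < (δ : WithBot Ordinal.{u})) {x : ZFSet.{u}}
    (hx : x ∈ M (nxt i)) : ∃ ε < d i, x ∈ N i ε := by
  obtain ⟨a, ha, hp⟩ := hM.complementary i hi
  have hcont := hp.chain.cont
  rw [ha] at hcont
  exact (hcont _ le_rfl (hM.isSuccLimit hi) x).1 (hM.top_eq i hi ▸ hx)

/-- The approximation of `M (i + 1)` ends in that model, and its traces come from `family₀`. Hence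
successor traces avoid `S`, as does the initial one, which corresponds to `i = -1`. -/
theorem IsRuledBy.trace_approx (hM : IsRuledBy κ κ χ W (family₀ κ S) (family₁ S C) M δ N d)
    {tr : Ordinal.{u} → Ordinal.{u}} (ht : IsTrace κ S M δ tr)
    {i : WithBot Ordinal.{u}} (hi : i < (δ : WithBot Ordinal.{u})) :
    tr (nxt i) ∉ S ∧
      ∀ ε < d i, ∃ b < tr (nxt i), ∀ β < κ.ord, β.toZFSet ∈ N i ε → β < b := by
  obtain ⟨a, ha, hp⟩ := hM.complementary i hi
  obtain ⟨α, hακ, hαS, hα, hb⟩ := hp.exists_trace (ha ▸ hM.isSuccLimit hi)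
  rw [ha, hM.top_eq i hi] at hα
  have hiδ : nxt i ≤ δ := nxt_le_iff.2 hi
  have e : α = tr (nxt i) := by
    refine eq_of_forall_lt_iff fun β => ⟨fun hβ => ?_, fun hβ => ?_⟩
    · have hβκ := hβ.trans hακ
      exact (ht.mem_iff _ hiδ β hβκ).1 ((hα β hβκ).2 hβ)
    · have hβκ := hβ.trans (ht.lt _ hiδ)
      exact (hα β hβκ).1 ((ht.mem_iff _ hiδ β hβκ).2 hβ)
  rw [← e]
  exact ⟨hαS, ha ▸ hb⟩

/-- A small set of ordinals below the trace of a successor model is bounded there. -/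
theorem IsRuledBy.exists_bound (hM : IsRuledBy κ κ χ W (family₀ κ S) (family₁ S C) M δ N d)
    {tr : Ordinal.{u} → Ordinal.{u}} (ht : IsTrace κ S M δ tr) {i : Ordinal.{u}} (hi : i < δ)
    {D : Set Ordinal.{u}} (hD : #D ≤ Cardinal.lift.{u + 1} (M i).card) :
    ∃ ρ < tr (i + 1), ∀ ξ ∈ D, ξ < tr (i + 1) → ξ < ρ := by
  have hi' : (i : WithBot Ordinal.{u}) < (δ : WithBot Ordinal.{u}) := WithBot.coe_lt_coe.2 hi
  have hiδ : i + 1 ≤ δ := nxt_le_iff.2 hi'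
  have hκ : ∀ ξ, ξ < tr (i + 1) → ξ < κ.ord := fun ξ hξ => hξ.trans (ht.lt _ hiδ)
  have hex : ∀ ξ, ξ < tr (i + 1) → ∃ ε < d i, ξ.toZFSet ∈ N i ε := fun ξ hξ =>
    hM.mem_approx hi' ((ht.mem_iff _ hiδ ξ (hκ ξ hξ)).2 hξ)
  choose! ε hε hεN using hex
  have hcard : #(D ∩ Set.Iio (tr (i + 1)) : Set Ordinal.{u}) < Cardinal.lift.{u + 1} (d i).cof := by
    refine (Cardinal.mk_le_mk_of_subset inter_subset_left).trans_lt (hD.trans_lt ?_)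
    rw [Cardinal.lift_lt]
    exact (Cardinal.cantor _).trans (hM.cof_gt i hi')
  -- Fewer than `cf (d i)` points appear together in one model `N i ε'`, whose trace is bounded
  -- below `tr (i + 1)`.
  obtain ⟨ε', hε', H⟩ := exists_bound_of_lt_cof hcard (fun ξ => ε ξ) (fun ξ => hε ξ ξ.2.2)
  obtain ⟨b, hb, hbN⟩ := (hM.trace_approx ht hi').2 ε' hε'
  refine ⟨b, hb, fun ξ hξ hlt => hbN ξ (hκ ξ hlt) ?_⟩
  obtain ⟨a, ha, hp⟩ := hM.complementary i hi'
  exact hp.chain.mono _ _ (H ⟨ξ, hξ, hlt⟩).le (ha ▸ hε'.le) (hεN ξ hlt)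

theorem IsRuledBy.param_mem {E₀ E₁ : Set SetSeq.{u}} (hM : IsRuledBy κ κ χ W E₀ E₁ M δ N d)
    {x : ZFSet.{u}} (hx : x ∈ M 0) {i : Ordinal.{u}} (hi : i ≤ δ) : x ∈ M i :=
  hM.chain.mono 0 i zero_le hi hx

/-- The union of the sets `A α`, where `α` is the trace of a model and belongs to `S`. -/
def ladderUnion (S : Set Ordinal.{u}) (A : Ordinal.{u} → Set Ordinal.{u})
    (tr : Ordinal.{u} → Ordinal.{u}) (δ : Ordinal.{u}) : Set Ordinal.{u} :=
  ⋃ k : {k : Set.Iio (δ + 1) // tr k ∈ S}, A (tr k.1)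

/-- Both factors are at most `|M i|`: there are at most `|δ| + 1` ladders, with `|δ| ≤ |M 0|`, and
each has size below `θ`, where `θ ∈ M 0` gives `θ ≤ |M i|`. -/
theorem mk_ladderUnion_le (hχ : ℵ₀ ≤ χ) (data : IsUniformizationData κ S θ A h)
    (hM : IsRuledBy κ κ χ W (family₀ κ S) (family₁ S C) M δ N d)
    {tr : Ordinal.{u} → Ordinal.{u}} (ht : IsTrace κ S M δ tr) (hx : param κ S θ A h ∈ M 0)
    {i : Ordinal.{u}} (hi : i ≤ δ) :
    #(ladderUnion S A tr δ) ≤ Cardinal.lift.{u + 1} (M i).card := by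
  have hθκ : θ.ord < κ.ord := Cardinal.ord_lt_ord.2 data.lt
  have hθi : θ ≤ (M i).card := by
    have h1 := (hM.chain.elem i hi).theta_mem hχ (hM.param_mem hx hi)
    have h2 := ht.card_toZFSet_le hi ((ht.mem_iff i hi _ hθκ).1 h1).le
    rwa [Cardinal.card_ord] at h2
  have hinf : ℵ₀ ≤ (M i).card := data.regular.aleph0_le.trans hθi
  have hδi : δ.card ≤ (M i).card :=
    ht.card_le.trans (ZFSet.card_mono (hM.chain.mono 0 i zero_le hi))
  have h1 : #{k : Set.Iio (δ + 1) // tr k ∈ S} ≤ Cardinal.lift.{u + 1} (M i).card := by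
    refine (Cardinal.mk_subtype_le _).trans ?_
    rw [Cardinal.mk_Iio_ordinal, Cardinal.lift_le, Ordinal.card_add_one]
    exact Cardinal.add_le_of_le hinf hδi (one_le_aleph0.trans hinf)
  have h2 : ⨆ k : {k : Set.Iio (δ + 1) // tr k ∈ S}, #(A (tr k.1)) ≤
      Cardinal.lift.{u + 1} (M i).card := by
    refine ciSup_le' fun k => ?_
    exact (data.card_lt _ k.2).le.trans (Cardinal.lift_le.2 hθi)
  refine (Cardinal.mk_iUnion_le _).trans ((mul_le_mul' h1 h2).trans ?_)
  rw [Cardinal.mul_eq_self]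
  rwa [Cardinal.aleph0_le_lift]

/-- The domains of the answers of INC converge to the trace of the next model. -/
theorem IsRuledBy.domOf_answer (hχ : ℵ₀ ≤ χ) (data : IsUniformizationData κ S θ A h)
    (hdense : ∀ α < κ.ord, (unifForcing κ S θ A h).IsDense (unifDomainSet κ S θ A h α))
    (hM : IsRuledBy κ κ χ W (family₀ κ S) (family₁ S C) M δ N d)
    {tr : Ordinal.{u} → Ordinal.{u}} (ht : IsTrace κ S M δ tr) (hx : param κ S θ A h ∈ M 0)
    {i : WithBot Ordinal.{u}} (hi : i < (δ : WithBot Ordinal.{u})) {α : Ordinal.{u}}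
    (hα : α < d i) {q : Ordinal.{u} → ZFSet.{u}} {n : ℕ}
    (hq : (unifForcing κ S θ A h).IsGeneric (fun ε => N i (α + ε)) (d i) q n) :
    (∀ ε < d i, domOf (q ε) < tr (nxt i)) ∧ ∀ ξ < tr (nxt i), ∃ ε < d i, ξ < domOf (q ε) := by
  obtain ⟨a, ha, hp⟩ := hM.complementary i hi
  have hiδ : nxt i ≤ δ := nxt_le_iff.2 hi
  have hprin : IsPrincipal (· + ·) (d i) := fun b c hb hc => hM.indecomposable i hi b hb c hc
  -- Additive indecomposability makes the end segment from `α` have the same length and the same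
  -- last model.
  have hαd : α + d i = d i := hprin.add_eq_right hα
  have hle : ∀ ε ≤ d i, α + ε ≤ a.last := fun ε hε => by
    rw [ha, ← hαd]
    exact add_le_add_right hε α
  have htop : N i (α + d i) = M (nxt i) := by rw [hαd, hM.top_eq i hi]
  refine domOf_generic hχ hdense (hM.isSuccLimit hi) (fun ε hε => hp.chain.elem _ (hle ε hε))
    (fun j k hjk hk => hp.chain.mono _ _ (add_le_add_right hjk α) (hle k hk)) (fun x hx' => ?_)
    ?_ (ht.lt _ hiδ).le ?_ data.subset hq
  · rw [htop] at hx'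
    obtain ⟨ε, hε, hxε⟩ := hM.mem_approx hi hx'
    exact ⟨ε, hε, hp.chain.mono _ _ le_add_self (hle ε hε.le) hxε⟩
  · rw [htop]
    exact hM.param_mem hx hiδ
  · rw [htop]
    exact ht.mem_iff _ hiδ

end Ruled

/-! ### COM's counterplay against a strategy of INC. -/

section Play

variable {κ θ : Cardinal.{u}} {S : Set Ordinal.{u}} {A : Ordinal.{u} → Set Ordinal.{u}}
  {C : Ordinal.{u} → Set Ordinal.{u}} {h : Ordinal.{u} → Ordinal.{u} → Ordinal.{u}}
  {χ : Cardinal.{u}} {W : H χ → H χ → Prop} {M : Ordinal.{u} → ZFSet.{u}} {δ : Ordinal.{u}}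
  {N : WithBot Ordinal.{u} → Ordinal.{u} → ZFSet.{u}} {d : WithBot Ordinal.{u} → Ordinal.{u}}

/-- The move `x` of COM at stage `i`, after the moves `P j` for `j < i`, is legal and follows the
condition `g` on the set `D` from the trace of the first model on. -/
structure IsFaithfulMove (Q : ForcingNotion.{u}) (M : Ordinal.{u} → ZFSet.{u})
    (d : WithBot Ordinal.{u} → Ordinal.{u}) (tr : Ordinal.{u} → Ordinal.{u})
    (D : Set Ordinal.{u}) (g : ZFSet.{u}) (σ : Game.StrategyINC.{u}) (i : WithBot Ordinal.{u})
    (P : WithBot Ordinal.{u} → ZFSet.{u}) (x : ZFSet.{u}) : Prop where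
  mem : x ∈ Q.carrier
  mem_model : x ∈ M (nxt i)
  opening : σ.opening ⊆ x
  answer : ∀ j, σ.start ≤ j → j < i → ∀ ε < d j, σ.answer P j ε ⊆ x
  follow : i ≠ σ.start → ∀ ξ ∈ D, tr (nxt σ.start) ≤ ξ → ξ < tr (nxt i) →
    ξ < domOf x ∧ fnOf x ξ = fnOf g ξ

/-- Causality of the strategy: the answers before `i` depend only on moves before `i`, which allows
COM's play to be defined by recursion. -/
theorem IsFaithfulMove.congr {Q : ForcingNotion.{u}} {tr : Ordinal.{u} → Ordinal.{u}}
    {D : Set Ordinal.{u}} {g : ZFSet.{u}} {σ : Game.StrategyINC.{u}} {i : WithBot Ordinal.{u}}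
    {P P' : WithBot Ordinal.{u} → ZFSet.{u}} {x : ZFSet.{u}} (hPP' : ∀ j < i, P j = P' j)
    (hx : IsFaithfulMove Q M d tr D g σ i P x) : IsFaithfulMove Q M d tr D g σ i P' x :=
  ⟨hx.mem, hx.mem_model, hx.opening, fun j hsj hji ε hε => by
    rw [← σ.causal P P' j fun k _ hkj => hPP' k (hkj.trans_lt hji)]
    exact hx.answer j hsj hji ε hε, hx.follow⟩

variable {tr : Ordinal.{u} → Ordinal.{u}} {g r : ZFSet.{u}} {σ : Game.StrategyINC.{u}}
  {P : WithBot Ordinal.{u} → ZFSet.{u}}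

theorem IsFaithfulMove.legal {D : Set Ordinal.{u}} {i : WithBot Ordinal.{u}}
    (hx : IsFaithfulMove (unifForcing κ S θ A h) M d tr D g σ i P (P i)) :
    Game.LegalCOM ⟨unifForcing κ S θ A h, M, δ, N, d, r⟩ σ.start σ.opening P (σ.answer P) i :=
  ⟨hx.mem, hx.mem_model, hx.opening, hx.answer⟩

/-- If COM has followed `g` at all stages before `i`, then all the moves before `i` have an upper
bound whose domain is the trace of `M i`. -/
theorem exists_bound_of_faithful (hχ : ℵ₀ ≤ χ) (data : IsUniformizationData κ S θ A h)
    (hdense : ∀ α < κ.ord, (unifForcing κ S θ A h).IsDense (unifDomainSet κ S θ A h α))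
    (hM : IsRuledBy κ κ χ W (family₀ κ S) (family₁ S C) M δ N d)
    (ht : IsTrace κ S M δ tr) (hx : param κ S θ A h ∈ M 0)
    (hg : g ∈ (unifForcing κ S θ A h).carrier) (hgδ : tr δ < domOf g)
    (hσ : ∀ (P : WithBot Ordinal.{u} → ZFSet.{u}) (i : WithBot Ordinal.{u}),
      σ.start ≤ i → i < (δ : WithBot Ordinal.{u}) →
      (∀ j, σ.start ≤ j → j ≤ i → Game.LegalCOM ⟨unifForcing κ S θ A h, M, δ, N, d, r⟩
        σ.start σ.opening P (σ.answer P) j) →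
      Game.LegalINC ⟨unifForcing κ S θ A h, M, δ, N, d, r⟩ P (σ.answer P) i)
    {i : Ordinal.{u}} (hiδ : i ≤ δ) (hsi : σ.start < (i : WithBot Ordinal.{u}))
    (hP : ∀ j, σ.start ≤ j → j < (i : WithBot Ordinal.{u}) →
      IsFaithfulMove (unifForcing κ S θ A h) M d tr (ladderUnion S A tr δ) g σ j P (P j)) :
    ∃ u ∈ (unifForcing κ S θ A h).carrier, domOf u = tr i ∧
      (∀ j, σ.start ≤ j → j < (i : WithBot Ordinal.{u}) → P j ⊆ u ∧
        ∀ ε < d j, σ.answer P j ε ⊆ u) ∧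
      ∀ ξ ∈ ladderUnion S A tr δ, tr (nxt σ.start) ≤ ξ → ξ < tr i → fnOf u ξ = fnOf g ξ := by
  set s := σ.start with hs
  have hlt : ∀ j, j < (i : WithBot Ordinal.{u}) → j < (δ : WithBot Ordinal.{u}) := fun j hj =>
    hj.trans_le (WithBot.coe_le_coe.2 hiδ)
  have hINC : ∀ j, s ≤ j → j < (i : WithBot Ordinal.{u}) →
      Game.LegalINC ⟨unifForcing κ S θ A h, M, δ, N, d, r⟩ P (σ.answer P) j := fun j hsj hji =>
    hσ P j hsj (hlt j hji) fun k hsk hkj => (hP k hsk (hkj.trans_lt hji)).legal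
  have hdpos : ∀ j, j < (i : WithBot Ordinal.{u}) → 0 < d j := fun j hj =>
    (hM.isSuccLimit (hlt j hj)).bot_lt
  have hdom : ∀ j, s ≤ j → j < (i : WithBot Ordinal.{u}) →
      (∀ ε < d j, domOf (σ.answer P j ε) < tr (nxt j)) ∧
        ∀ ξ < tr (nxt j), ∃ ε < d j, ξ < domOf (σ.answer P j ε) := by
    intro j hsj hji
    obtain ⟨-, -, α, hα, n, hgen⟩ := hINC j hsj hji
    exact hM.domOf_answer hχ data hdense ht hx (hlt j hji) hα hgen
  have htrle : ∀ j, j < (i : WithBot Ordinal.{u}) → tr (nxt j) ≤ tr i := fun j hj =>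
    ht.mono (nxt_le_iff.2 hj) hiδ
  have hstage : ∀ ξ < tr i, ∃ j, s ≤ j ∧ j < (i : WithBot Ordinal.{u}) ∧ ξ < tr (nxt j) := by
    intro ξ hξ
    rcases Ordinal.zero_or_succ_or_isSuccLimit i with rfl | ⟨k, rfl⟩ | hlim
    · have hbot : s = ⊥ := by
        cases hs' : s with
        | bot => rfl
        | coe k =>
          rw [hs'] at hsi
          exact absurd (WithBot.coe_lt_coe.1 hsi) not_lt_zero
      exact ⟨s, le_rfl, hsi, by rw [hbot]; exact hξ⟩
    · refine ⟨(k : WithBot Ordinal.{u}), ?_, WithBot.coe_lt_coe.2 (lt_succ k), hξ⟩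
      rw [← nxt_le_iff] at hsi
      cases hs' : s with
      | bot => exact bot_le
      | coe m =>
        rw [hs'] at hsi
        exact WithBot.coe_le_coe.2 (Order.succ_le_succ_iff.1 hsi)
    · have hξκ := hξ.trans (ht.lt i hiδ)
      obtain ⟨k, hk, hξk⟩ := (hM.chain.cont i hiδ hlim _).1 ((ht.mem_iff i hiδ ξ hξκ).2 hξ)
      have hk' : (k : WithBot Ordinal.{u}) < i := WithBot.coe_lt_coe.2 hk
      have hm := max_lt hsi hk'
      refine ⟨max s k, le_max_left _ _, hm, ?_⟩
      refine ((ht.mem_iff k (hk.le.trans hiδ) ξ hξκ).1 hξk).trans_le (ht.mono ?_ ?_)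
      · by_contra! hlt'
        have h1 := nxt_le_iff.1 hlt'.le
        exact absurd (h1.trans_le (le_max_right s (k : WithBot Ordinal.{u}))) (lt_irrefl _)
      · exact (nxt_le_iff.2 hm).trans hiδ
  -- It is enough to take the union of INC's answers, since each move of COM lies below the answer
  -- to it.
  let ι := {x : WithBot Ordinal.{u} × Ordinal.{u} // s ≤ x.1 ∧ x.1 < i ∧ x.2 < d x.1}
  let G : ι → ZFSet.{u} := fun x => σ.answer P x.1.1 x.1.2
  have hGQ : ∀ x, G x ∈ (unifForcing κ S θ A h).carrier := fun x =>
    (hINC x.1.1 x.2.1 x.2.2.1).1.1 _ x.2.2.2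
  have hPq : ∀ j, s ≤ j → j < (i : WithBot Ordinal.{u}) → P j ⊆ σ.answer P j 0 :=
    fun j hsj hji => (hINC j hsj hji).2.1
  have hq0 : ∀ j, s ≤ j → j < (i : WithBot Ordinal.{u}) → ∀ ε < d j,
      σ.answer P j 0 ⊆ σ.answer P j ε := fun j hsj hji ε hε =>
    (hINC j hsj hji).1.2 0 ε zero_le hε
  have hGlt : ∀ x y : ι, x.1.1 < y.1.1 → G x ⊆ G y := fun x y hxy z hz =>
    hq0 _ y.2.1 y.2.2.1 _ y.2.2.2 (hPq _ y.2.1 y.2.2.1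
      ((hP _ y.2.1 y.2.2.1).answer _ x.2.1 hxy _ x.2.2.2 hz))
  have hfollow : ∀ ξ ∈ ladderUnion S A tr δ, tr (nxt s) ≤ ξ → ξ < tr i →
      ∃ x : ι, ξ < domOf (G x) ∧ fnOf (G x) ξ = fnOf g ξ := by
    intro ξ hξ hle hξi
    obtain ⟨j, hsj, hji, hξj⟩ := hstage ξ hξi
    have hne : j ≠ s := by
      rintro rfl
      exact hle.not_gt hξj
    obtain ⟨h1, h2⟩ := (hP j hsj hji).follow hne ξ hξ hle hξj
    have hsub := (subset_iff_of_mem (hP j hsj hji).mem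
      (hGQ ⟨(j, 0), hsj, hji, hdpos j hji⟩)).1 (hPq j hsj hji)
    exact ⟨⟨(j, 0), hsj, hji, hdpos j hji⟩, h1.trans_le hsub.1, (hsub.2 ξ h1).symm.trans h2⟩
  obtain ⟨u, hu, hudom, hGu⟩ := exists_union_mem data.subset G hGQ
    (fun x y => by
      rcases lt_trichotomy x.1.1 y.1.1 with hxy | hxy | hxy
      · exact Or.inl (hGlt x y hxy)
      · obtain ⟨⟨j, ε⟩, hx1, hx2, hx3⟩ := x
        obtain ⟨⟨j', ε'⟩, hy1, hy2, hy3⟩ := y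
        obtain rfl : j = j' := hxy
        exact (le_total ε ε').imp (fun hle => (hINC j hx1 hx2).1.2 ε ε' hle hy3)
          (fun hle => (hINC j hx1 hx2).1.2 ε' ε hle hx3)
      · exact Or.inr (hGlt y x hxy))
    (ht.lt i hiδ)
    (fun x => ((hdom _ x.2.1 x.2.2.1).1 _ x.2.2.2).le.trans (htrle _ x.2.2.1))
    (fun ξ hξ => by
      obtain ⟨j, hsj, hji, hξj⟩ := hstage ξ hξ
      obtain ⟨ε, hε, hlt'⟩ := (hdom j hsj hji).2 ξ hξj
      exact ⟨⟨(j, ε), hsj, hji, hε⟩, hlt'⟩)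
    (fun hS => by
      -- The trace of the model where play starts is off `S`. So if `tr i ∈ S`, that trace is
      -- strictly below `tr i`, and following `g` from there on covers a tail of `A (tr i)`.
      have hne : nxt s ≠ i := by
        intro e
        have := (hM.trace_approx ht (hlt s hsi)).1
        rw [e] at this
        exact this hS
      have hlt' : tr (nxt s) < tr i :=
        ht.strictMono _ _ ((nxt_le_iff.2 hsi).lt_of_ne hne) hiδ
      obtain ⟨γ, hγ, Hγ⟩ := (isGood_of_mem data.subset hg).agree (tr i) hS
        ((ht.mono hiδ le_rfl).trans hgδ.le)
      refine ⟨max γ (tr (nxt s)), max_lt hγ hlt', fun ξ hξ hle => ?_⟩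
      obtain ⟨x, hx1, hx2⟩ := hfollow ξ
        (mem_iUnion.2 ⟨⟨⟨i, lt_succ_of_le hiδ⟩, hS⟩, hξ⟩)
        ((le_max_right _ _).trans hle) (data.subset _ hS hξ)
      exact ⟨x, hx1, hx2.trans (Hγ ξ hξ ((le_max_left _ _).trans hle))⟩)
  refine ⟨u, hu, hudom, fun j hsj hji => ⟨fun z hz => ?_, fun ε hε => ?_⟩, fun ξ hξ hle hξi => ?_⟩
  · exact hGu ⟨(j, 0), hsj, hji, hdpos j hji⟩ (hPq j hsj hji hz)
  · exact hGu ⟨(j, ε), hsj, hji, hε⟩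
  · obtain ⟨x, hx1, hx2⟩ := hfollow ξ hξ hle hξi
    rw [← hx2]
    exact (((subset_iff_of_mem (hGQ x) hu).1 (hGu x)).2 ξ hx1).symm

theorem not_isWinning (hyp : StandingHypothesis κ S C) (hχ : ℵ₀ ≤ χ)
    (data : IsUniformizationData κ S θ A h)
    (hdense : ∀ α < κ.ord, (unifForcing κ S θ A h).IsDense (unifDomainSet κ S θ A h α))
    (hM : IsRuledBy κ κ χ W (family₀ κ S) (family₁ S C) M δ N d)
    (hx : param κ S θ A h ∈ M 0) (σ : Game.StrategyINC.{u}) :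
    ¬ σ.IsWinning ⟨unifForcing κ S θ A h, M, δ, N, d, r⟩ := by
  rintro ⟨⟨hnxt, hopQ, hopM, -⟩, hσ, hno⟩
  dsimp only at hnxt hopQ hopM hσ
  have hδ : 0 < δ := pos_of_gt hnxt
  obtain ⟨tr, ht⟩ := hM.exists_trace hyp hδ
  have hsδ : σ.start < (δ : WithBot Ordinal.{u}) := nxt_le_iff.1 hnxt.le
  -- The guide `g` need not lie in any of the models, nor be compatible with the play; only its
  -- values on the ladders are copied.
  obtain ⟨g, hg, -⟩ := (hdense (tr δ) (ht.lt δ le_rfl)).2 _ hopQ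
  obtain ⟨hgQ, hgδ⟩ := mem_unifDomainSet.1 hg
  obtain ⟨P, hP⟩ := exists_recursive_choice
    (IsFaithfulMove (unifForcing κ S θ A h) M d tr (ladderUnion S A tr δ) g σ)
    (fun i f f' x hff' hx => hx.congr hff')
  have key : ∀ i, σ.start ≤ i → i < (δ : WithBot Ordinal.{u}) →
      IsFaithfulMove (unifForcing κ S θ A h) M d tr (ladderUnion S A tr δ) g σ i P (P i) := by
    intro i
    induction i using WellFoundedLT.induction with
    | _ i ih =>
    intro hsi hiδ
    refine hP i ?_
    rcases hsi.eq_or_lt with rfl | hlt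
    -- The opening stage has no demand to follow `g`: COM repeats INC's condition.
    · exact ⟨σ.opening, hopQ, hopM, fun _ hz => hz, fun j hj hj' => absurd hj' hj.not_gt,
        fun hne => absurd rfl hne⟩
    cases i with
    | bot => exact absurd hlt not_lt_bot
    | coe i =>
    have hi : i < δ := WithBot.coe_lt_coe.1 hiδ
    have hi1 : i + 1 ≤ δ := nxt_le_iff.2 hiδ
    obtain ⟨u, hu, hudom, hsub, hfollow⟩ := exists_bound_of_faithful hχ data hdense hM ht hx hgQ hgδ
      hσ hi.le hlt (P := P) (fun j hsj hji => ih j hji hsj (hji.trans hiδ))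
    obtain ⟨ρ, hρ, hρD⟩ := hM.exists_bound ht hi (mk_ladderUnion_le hχ data hM ht hx hi.le)
    have hmax : max ρ (tr i) < tr (i + 1) := max_lt hρ (ht.strictMono _ _ (lt_add_one i) hi1)
    -- Copying `g` up to `max ρ (tr i)` catches every ladder point below `tr (i + 1)`, yet stays
    -- below `tr (i + 1)`, so that the move lies in the next model.
    obtain ⟨x, hxQ, hxdom, hux, hxg⟩ := exists_patch_mem data.subset hu hgQ
      (hudom.le.trans (le_max_right ρ (tr i)))
      ((hmax.le.trans (ht.mono hi1 le_rfl)).trans hgδ.le)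
    refine ⟨x, hxQ, ?_, fun z hz => ?_, fun j hsj hji ε hε z hz => ?_, fun _ ξ hξ hle hξi => ?_⟩
    · exact (hM.chain.elem _ hi1).cond_mem hχ hyp.inaccessible data (hM.param_mem hx hi1)
        (ht.mem_iff _ hi1) hxQ (hxdom ▸ hmax)
    · exact hux ((hsub _ le_rfl hlt).1 ((ih _ hlt le_rfl hsδ).opening hz))
    · exact hux ((hsub j hsj hji).2 ε hε hz)
    · have hξx : ξ < domOf x := hxdom ▸ (hρD ξ hξ hξi).trans_le (le_max_left _ _)
      refine ⟨hξx, ?_⟩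
      rcases lt_or_ge ξ (tr i) with hlt' | hge
      · rw [← hfollow ξ hξ hle hlt']
        exact (((subset_iff_of_mem hu hxQ).1 hux).2 ξ (hudom ▸ hlt')).symm
      · exact hxg ξ (hudom ▸ hge) (hxdom ▸ hξx)
  -- The same bound at `i = δ` finishes the play; `tr δ ∈ S`, and its ladder is among those
  -- followed.
  obtain ⟨u, hu, -, hsub, -⟩ := exists_bound_of_faithful hχ data hdense hM ht hx hgQ hgδ
    hσ le_rfl hsδ (P := P) key
  exact hno ⟨P, fun i hsi hiδ => (key i hsi hiδ).legal, u, hu, fun i hsi hiδ => (hsub i hsi hiδ).1⟩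

end Play

end UnifForcing

theorem mainTheorem11 (κ θ : Cardinal.{u}) (S : Set Ordinal.{u})
    (C : Ordinal.{u} → Set Ordinal.{u}) (A : Ordinal.{u} → Set Ordinal.{u})
    (h : Ordinal.{u} → Ordinal.{u} → Ordinal.{u})
    (hyp : UnifForcing.StandingHypothesis κ S C)
    (data : UnifForcing.IsUniformizationData κ S θ A h) :
    ((∀ α < κ.ord, (UnifForcing.unifForcing κ S θ A h).IsDense
        (UnifForcing.unifDomainSet κ S θ A h α)) →
      (UnifForcing.unifForcing κ S θ A h).CompleteForPair κ κ
        (UnifForcing.family₀ κ S) (UnifForcing.family₁ S C)) ∧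
    (UnifForcing.NonReflecting κ S →
      (∀ δ ∈ S, ∀ δ' ∈ S, δ' < δ → ∃ γ < δ', ∀ ξ ∈ A δ, ξ < δ' → ξ < γ) →
      ∀ α < κ.ord, (UnifForcing.unifForcing κ S θ A h).IsDense
        (UnifForcing.unifDomainSet κ S θ A h α)) := by
  refine ⟨fun hdense => ⟨⟨UnifForcing.completeFor_family₀ hyp data hdense,
    UnifForcing.addsNoNewSequences hyp data hdense⟩, ?_⟩, fun hS hbdd α hα =>
    UnifForcing.isDense_unifDomainSet hyp data hS hbdd hα⟩
  obtain ⟨χ₀, hχ₀⟩ := UnifForcing.exists_forall_inH (UnifForcing.param κ S θ A h)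
  refine ⟨χ₀, fun χ hχ hreg W _ => ⟨UnifForcing.param κ S θ A h, hχ₀ χ hχ, ?_⟩⟩
  rintro M δ N d hM hx r - - ⟨σ, hσ⟩
  exact UnifForcing.not_isWinning hyp hreg.aleph0_le data hdense hM hx σ hσ
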